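/- Let $p$ be an odd prime. Let $\Gamma_p:\mathbb{Z}_p\to\mathbb{Z}_p^*$ be Morita's $p$-adic gamma function: $\Gamma_p(0)=1$, $\Gamma_p(n)=(-1)^n\prod_{0<j<n,\ p\nmid j}j$ for positive integers $n$, and $\Gamma_p(x)=\lim_{n\to x}\Gamma_p(n)$ for $0\neq x\in\mathbb{Z}_p$, where $n$ runs through positive integers tending $p$-adically to $x$. Let $\omega:\mathbb{F}_p\to\mathbb{Z}_p$ be the Teichmüller character, i.e. the multiplicative character of $\mathbb{F}_p$ with $\omega(x)\equiv x \pmod p$ for all $x \in \mathbb{F}_p$; let $\bar\omega$ be its inverse character. All multiplicative characters, including the trivial one, take the value $0$ at $0$. For $x\in\mathbb{Q}$ let $\lfloor x\rfloor$ be the greatest integer less than or equal to $x$, and $\langle x\rangle=x-\lfloor x\rfloor$. For $n\in\mathbb{Z}^+$, $a_i,b_i\in\mathbb{Q}\cap\mathbb{Z}_p$ $(1\le i\le n)$ and $s\in\mathbb{F}_p$ define $${}_nG_n\!\left[\begin{array}{ccc}a_1&\dots&a_n\\ b_1&\dots&b_n\end{array}\Big|\,s\right]_p:=\frac{-1}{p-1}\sum_{j=0}^{p-2}(-1)^{jn}\,\bar\omega^j(s)\prod_{i=1}^n\frac{\Gamma_p(\langle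 a_i-\frac{j}{p-1}\rangle)}{\Gamma_p(\langle a_i\rangle)}\,\frac{\Gamma_p(\langle -b_i+\frac{j}{p-1}\rangle)}{\Gamma_p(\langle -b_i\rangle)}\,(-p)^{-\lfloor\langle a_i\rangle-\frac{j}{p-1}\rfloor-\lfloor\langle -b_i\rangle+\frac{j}{p-1}\rfloor}\in\mathbb{Q}_p.$$ Theorem. Let $p$ be an odd prime, $s\in\mathbb{F}_p$, $n\in\mathbb{Z}^+$, and $a_1,\dots,a_n\in\mathbb{Q}\cap\mathbb{Z}_p$. Then $${}_{n+1}G_{n+1}\!\left[\begin{array}{cccc}a_1&\dots&a_n&\frac12\\ 1&\dots&1&1\end{array}\Big|\,s\right]_p=-\sum_{t=2}^{p-1}{}_nG_n\!\left[\begin{array}{ccc}a_1&\dots&a_n\\ 1&\dots&1\end{array}\Big|\,st\right]_p\cdot\omega^{\frac{p-1}{2}}(1-t).$$ -/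

import Mathlib

open Filter Topology

noncomputable section

namespace PadicHypergeometric

variable (p : ℕ) [Fact p.Prime]

/-! ### The Teichmüller character -/

/-- The Teichmüller character `ω` of `𝔽_p`, with values in `ℤ_p` and with `ω(0) = 0`: the
Teichmüller lift `𝔽_p → W(𝔽_p)` followed by the identification of `W(𝔽_p)` with `ℤ_p`.
Its inverse in the group of multiplicative characters is `ω⁻¹`; every power of `ω`, including the
trivial character `ω ^ 0`, takes the value `0` at `0`. -/
def teichmullerChar : MulChar (ZMod p) ℤ_[p] where
  toMonoidHom := (WittVector.equiv p : WittVector p (ZMod p) →* ℤ_[p]).comp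
    (WittVector.teichmuller p)
  map_nonunit' a ha := by
    have h0 : a = 0 := by
      by_contra h
      exact ha (isUnit_iff_ne_zero.mpr h)
    subst h0
    change WittVector.equiv p (WittVector.teichmuller p 0) = 0
    rw [WittVector.teichmuller_zero, map_zero]

/-- The characteristic property of the Teichmüller character: `ω(x) ≡ x (mod p)`. -/
theorem toZMod_teichmullerChar (x : ZMod p) :
    PadicInt.toZMod (teichmullerChar p x) = x := by
  have key : (WittVector.constantCoeff : WittVector p (ZMod p) →+* ZMod p).comp
      (WittVector.equiv p).symm.toRingHom = PadicInt.toZMod := by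
    apply ZMod.ringHom_eq_of_ker_eq
    rw [PadicInt.ker_toZMod]
    have hs : Function.Surjective
        ((WittVector.constantCoeff : WittVector p (ZMod p) →+* ZMod p).comp
          (WittVector.equiv p).symm.toRingHom) := ZMod.ringHom_surjective _
    exact IsLocalRing.eq_maximalIdeal (RingHom.ker_isMaximal_of_surjective _ hs)
  have h := congrArg (fun f : ℤ_[p] →+* ZMod p => f (teichmullerChar p x)) key
  rw [← h]
  change WittVector.constantCoeff ((WittVector.equiv p).symm
    (WittVector.equiv p (WittVector.teichmuller p x))) = x
  rw [RingEquiv.symm_apply_apply]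
  exact WittVector.teichmuller_coeff_zero p x

/-! ### Morita's `p`-adic gamma function -/

/-- `Γ_p(n) = (-1)^n ∏_{0 < j < n, p ∤ j} j` for positive integers `n`. -/
def gammaNat (n : ℕ) : ℤ_[p] :=
  (-1) ^ n * ∏ j ∈ (Finset.Ioo 0 n).filter (fun j => ¬ p ∣ j), (j : ℤ_[p])

/-- Morita's `p`-adic gamma function on `ℤ_p`: `Γ_p(0) = 1`, and `Γ_p(x)` is the limit of
`Γ_p(n)` as the positive integer `n` tends `p`-adically to `x` if `x ≠ 0`. -/
def gamma (x : ℤ_[p]) : ℤ_[p] :=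
  open Classical in
  if x = 0 then 1
  else limUnder (comap (fun n : ℕ => (n : ℤ_[p])) (𝓝 x) ⊓ 𝓟 {n : ℕ | 0 < n}) (gammaNat p)

/-- `Γ_p(x)` for a rational number `x ∈ ℚ ∩ ℤ_p`, as an element of `ℚ_p`
(with the value `0` at rational numbers that are not `p`-integral). -/
def gammaRat (x : ℚ) : ℚ_[p] :=
  open Classical in
  if h : ‖(x : ℚ_[p])‖ ≤ 1 then ((gamma p ⟨(x : ℚ_[p]), h⟩ : ℤ_[p]) : ℚ_[p]) else 0

/-! ### The `p`-adic hypergeometric function -/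

/-- The function `ₙGₙ[a₁, …, aₙ; b₁, …, bₙ | s]_p`, with values in `ℚ_p`. Here `Int.fract` is the
fractional part `⟨·⟩`, and the products with integer exponents are taken in `ℚ_p`. -/
def G {n : ℕ} (a b : Fin n → ℚ) (s : ZMod p) : ℚ_[p] :=
  -1 / ((p : ℚ_[p]) - 1) * ∑ j ∈ Finset.range (p - 1),
    (-1) ^ (j * n) * ((((teichmullerChar p)⁻¹ ^ j) s : ℤ_[p]) : ℚ_[p]) *
      ∏ i : Fin n,
        (gammaRat p (Int.fract (a i - (j : ℚ) / ((p : ℚ) - 1))) / gammaRat p (Int.fract (a i))) *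
        (gammaRat p (Int.fract (-b i + (j : ℚ) / ((p : ℚ) - 1))) / gammaRat p (Int.fract (-b i))) *
        (-(p : ℚ_[p])) ^ (-⌊Int.fract (a i) - (j : ℚ) / ((p : ℚ) - 1)⌋
          - ⌊Int.fract (-b i) + (j : ℚ) / ((p : ℚ) - 1)⌋)

end PadicHypergeometric

end

/-! Both sides are sums over `j` of powers of the inverse Teichmüller character at `s`. Since
`ω̄^j(st) = ω̄^j(s) ω̄^j(t)`, interchanging the sums over `t` and `j` reduces the claim to one
identity for each `j`. Let `φ` be the quadratic character. The sum over `t` of `ω̄^j(t) φ(1 - t)` is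
the Jacobi sum `J(ω̄^j, φ)`, and it must equal `-(-1)^j` times the factor contributed by the
parameters `1/2` and `1` (`teichJacobi_half_eq`).

That identity is the Gross–Koblitz formula over `𝔽_p`, applied to the expression of Jacobi sums by
Gauss sums. The formula is proved by Dwork's method. Let `E = exp(X + X^p/p) = ∑ e_n X^n`, and let
`D(b, y) = ∑ e_(b+pl) p^l y(y+1)⋯(y+l-1)`, which is `dworkSum`.

Gamma side: at `y = -m` the sum `D(a, y)` is finite, and comparing coefficients in `exp(X) = E ·
exp(-X^p/p)` shows that it inverts `Γ_p(1+a+pm)` up to sign. By continuity `Γ_p(1+a-pz) =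
1/((-1)^(a+1) D(a, z))`.

Gauss sum side: choose `π` with `π^(p-1) = -p`. Then `t ↦ E(π ω(t))` is a nontrivial additive
character. Expanding `E` and using orthogonality, the Gauss sum of `ω^(-a)` becomes `(p-1) ∑ e_n
π^n` over `n ≡ a` mod `p-1`. The recursion for `e_n` identifies this with `-π^a D(a, a/(p-1))`
(`hasSum_dworkCoeff_arith`, `gaussSum_teichK`).

The analytic input is a bound `|e_n| ≤ R^n` with `R^p < p` (`norm_dworkCoeff_le`). It makes `D`
continuous in `y` and makes `E` converge on `|x| ≤ |π|`, a disc on which `exp` itself does not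
converge. -/

noncomputable section

namespace PadicHypergeometric

open PowerSeries

/-! ### Formal power series: derivatives and coefficient bounds -/

section PowerSeriesLemmas

theorem derivative_expand {R : Type*} [CommRing R] (n : ℕ) (hn : n ≠ 0) (f : R⟦X⟧) :
    d⁄dX R (expand n hn f) = (n : R⟦X⟧) * X ^ (n - 1) * expand n hn (d⁄dX R f) := by
  rw [expand_apply, expand_apply, derivative_subst (HasSubst.X_pow hn), derivative_pow,
    derivative_X]
  ring

theorem derivative_rescale {R : Type*} [CommRing R] (a : R) (f : R⟦X⟧) :
    d⁄dX R (rescale a f) = C a * rescale a (d⁄dX R f) := by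
  ext n
  rw [coeff_derivative, coeff_rescale, coeff_C_mul, coeff_rescale, coeff_derivative, pow_succ]
  ring

/-- Uniqueness for a first-order linear differential equation: in characteristic zero each
coefficient is determined by the earlier ones. It serves to identify two power series without
manipulating logarithms. -/
theorem eq_zero_of_derivative_eq_mul {F : Type*} [Field F] [CharZero F] {f g : F⟦X⟧}
    (h : d⁄dX F f = g * f) (h0 : constantCoeff f = 0) : f = 0 := by
  ext n
  rw [map_zero]
  induction n using Nat.strong_induction_on with
  | _ n ih =>
    rcases n with _ | n
    · rwa [coeff_zero_eq_constantCoeff_apply]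
    · have h1 := congrArg (coeff n) h
      rw [coeff_derivative, coeff_mul, Finset.sum_eq_zero] at h1
      · have : ((n : F) + 1) ≠ 0 := Nat.cast_add_one_ne_zero n
        exact (mul_eq_zero.1 h1).resolve_right this
      · intro x hx
        rw [ih x.2 (by have := Finset.HasAntidiagonal.mem_antidiagonal.1 hx; omega), mul_zero]

theorem norm_coeff_mul_le {F : Type*} [NormedField F] [IsUltrametricDist F] {f g : F⟦X⟧}
    {A B R : ℝ} (hA : 0 ≤ A) (hB : 0 ≤ B) (hR : 0 ≤ R) (hf : ∀ n, ‖coeff n f‖ ≤ A * R ^ n)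
    (hg : ∀ n, ‖coeff n g‖ ≤ B * R ^ n) (n : ℕ) : ‖coeff n (f * g)‖ ≤ A * B * R ^ n := by
  rw [coeff_mul]
  refine IsUltrametricDist.norm_sum_le_of_forall_le_of_nonneg (by positivity) fun x hx => ?_
  rw [norm_mul, ← Finset.HasAntidiagonal.mem_antidiagonal.1 hx, pow_add]
  calc _ ≤ (A * R ^ x.1) * (B * R ^ x.2) :=
        mul_le_mul (hf _) (hg _) (norm_nonneg _) (by positivity)
    _ = _ := by ring

theorem norm_coeff_pow_le {F : Type*} [NormedField F] [IsUltrametricDist F] {f : F⟦X⟧}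
    {A R : ℝ} (hA : 0 ≤ A) (hR : 0 ≤ R) (hf : ∀ n, ‖coeff n f‖ ≤ A * R ^ n) (k n : ℕ) :
    ‖coeff n (f ^ k)‖ ≤ A ^ k * R ^ n := by
  induction k generalizing n with
  | zero =>
    rw [pow_zero, pow_zero, one_mul, coeff_one]
    split_ifs with h
    · simp [h]
    · simpa using pow_nonneg hR n
  | succ k ih =>
    rw [pow_succ, pow_succ]
    exact norm_coeff_mul_le (pow_nonneg hA k) hA hR ih hf n

end PowerSeriesLemmas

/-! ### Dwork's exponential and the recursion for its coefficients -/

variable (p : ℕ) [hp : Fact p.Prime]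

/-- Dwork's power series `exp (X + X ^ p / p)` over `ℚ_p`. -/
def dworkExp : ℚ_[p]⟦X⟧ :=
  exp ℚ_[p] * expand p hp.out.ne_zero (rescale (p : ℚ_[p])⁻¹ (exp ℚ_[p]))

theorem natCast_prime_ne_zero : (p : ℚ_[p]) ≠ 0 := Nat.cast_ne_zero.2 hp.out.ne_zero

theorem constantCoeff_dworkExp : constantCoeff (dworkExp p) = 1 := by
  have : constantCoeff (rescale (p : ℚ_[p])⁻¹ (exp ℚ_[p])) = 1 := by
    rw [← coeff_zero_eq_constantCoeff_apply, coeff_rescale, coeff_exp]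
    simp
  rw [dworkExp, map_mul, constantCoeff_expand, this, constantCoeff_exp, mul_one]

theorem derivative_dworkExp :
    d⁄dX ℚ_[p] (dworkExp p) = (1 + X ^ (p - 1)) * dworkExp p := by
  have h : (p : ℚ_[p]⟦X⟧) * C (p : ℚ_[p])⁻¹ = 1 := by
    rw [← map_natCast (C (R := ℚ_[p])), ← map_mul, mul_inv_cancel₀ (natCast_prime_ne_zero p),
      map_one]
  rw [dworkExp, Derivation.leibniz, derivative_exp, derivative_expand, derivative_rescale,
    derivative_exp, map_mul, expand_C, smul_eq_mul, smul_eq_mul]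
  linear_combination (X ^ (p - 1) * exp ℚ_[p] *
    (expand p hp.out.ne_zero) (rescale (p : ℚ_[p])⁻¹ (exp ℚ_[p]))) * h

/-- Taking the `p`-th power clears the denominator in `X^p/p`. At a point with `x^p = -p x` the two
factors cancel, which is why values of the series there are `p`-th roots of unity. -/
theorem dworkExp_pow :
    dworkExp p ^ p = rescale (p : ℚ_[p]) (exp ℚ_[p]) * expand p hp.out.ne_zero (exp ℚ_[p]) := by
  rw [dworkExp, mul_pow, ← map_pow, ← map_pow, exp_pow_eq_rescale_exp, rescale_rescale,
    mul_inv_cancel₀ (natCast_prime_ne_zero p), rescale_one, RingHom.id_apply]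

/-- This is the link with factorials: the coefficients on the left are `1/N!`, and the second factor
involves only powers of `X^p`. -/
theorem exp_eq_dworkExp_mul :
    exp ℚ_[p] = dworkExp p * expand p hp.out.ne_zero (rescale (-(p : ℚ_[p])⁻¹) (exp ℚ_[p])) := by
  rw [dworkExp, mul_assoc, ← map_mul, exp_mul_exp_eq_exp_add, add_neg_cancel, rescale_zero]
  simp

/-- The coefficients of Dwork's power series. -/
def dworkCoeff (n : ℕ) : ℚ_[p] := coeff n (dworkExp p)

theorem dworkCoeff_zero : dworkCoeff p 0 = 1 := by
  rw [dworkCoeff, coeff_zero_eq_constantCoeff_apply, constantCoeff_dworkExp]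

/-- Compare coefficients in `E' = (1 + X^(p-1)) E`. -/
theorem succ_mul_dworkCoeff (n : ℕ) :
    dworkCoeff p (n + 1) * (n + 1) =
      dworkCoeff p n + if p ≤ n + 1 then dworkCoeff p (n + 1 - p) else 0 := by
  have h := congrArg (coeff n) (derivative_dworkExp p)
  rw [coeff_derivative, add_mul, one_mul, map_add, coeff_X_pow_mul'] at h
  rw [dworkCoeff, h]
  have := hp.out.pos
  congr 1
  by_cases h1 : p ≤ n + 1
  · rw [if_pos h1, if_pos (by omega), dworkCoeff]; congr 2; omega
  · rw [if_neg h1, if_neg (by omega)]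

theorem dworkCoeff_one : dworkCoeff p 1 = 1 := by
  have h := succ_mul_dworkCoeff p 0
  rw [if_neg (by have := hp.out.two_le; omega), dworkCoeff_zero] at h
  simpa using h

theorem norm_natCast_of_lt {n : ℕ} (h0 : n ≠ 0) (h : n < p) : ‖(n : ℚ_[p])‖ = 1 := by
  rw [Padic.norm_natCast_eq_one_iff]
  exact (Nat.coprime_of_lt_prime h0 h hp.out)

theorem norm_dworkCoeff_le_one {n : ℕ} (h : n < p) : ‖dworkCoeff p n‖ ≤ 1 := by
  induction n with
  | zero => rw [dworkCoeff_zero, norm_one]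
  | succ n ih =>
    have h1 := congrArg norm (succ_mul_dworkCoeff p n)
    rw [if_neg (by omega), add_zero, norm_mul] at h1
    have h2 := norm_natCast_of_lt p (n.succ_ne_zero) h
    push_cast at h2
    rw [h2, mul_one] at h1
    rw [h1]
    exact ih (by omega)

/-! ### Growth of the coefficients of Dwork's exponential -/

section Bound

theorem norm_natCast_eq_rpow {n : ℕ} (hn : n ≠ 0) :
    ‖(n : ℚ_[p])‖⁻¹ = (p : ℝ) ^ (padicValNat p n : ℝ) := by
  rw [Padic.norm_eq_zpow_neg_valuation (Nat.cast_ne_zero.2 hn), Padic.valuation_natCast,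
    zpow_neg, inv_inv, zpow_natCast, Real.rpow_natCast]

theorem norm_factorial_inv_le (k : ℕ) :
    ‖((k.factorial : ℕ) : ℚ_[p])‖⁻¹ ≤ ((p : ℝ) ^ (1 / ((p : ℝ) - 1))) ^ k := by
  have h2 : (2 : ℝ) ≤ p := by exact_mod_cast hp.out.two_le
  have h1 : (0 : ℝ) < (p : ℝ) - 1 := by linarith
  rw [norm_natCast_eq_rpow p k.factorial_ne_zero, ← Real.rpow_natCast, ← Real.rpow_mul (by linarith)]
  refine Real.rpow_le_rpow_of_exponent_le (by linarith) ?_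
  have h := sub_one_mul_padicValNat_factorial (p := p) k
  have h' : (p - 1) * padicValNat p k.factorial ≤ k := by omega
  have h3 : ((p : ℝ) - 1) * padicValNat p k.factorial ≤ k := by
    have := (Nat.cast_le (α := ℝ)).2 h'
    rwa [Nat.cast_mul, Nat.cast_sub hp.out.one_le, Nat.cast_one] at this
  rw [div_mul_eq_mul_div, le_div_iff₀ h1]
  linarith

omit hp in
-- The constant `5/6` is forced by `p = 3`, `n = 9`, where equality holds. The excluded `n = 1` and
-- `n = p` are the exponents absorbed into Dwork's exponential. The cases are valuation `0`,
-- valuation `1` (where `n ≥ 2p`), and valuation at least `2` (where exponential growth wins).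
theorem padicValNat_add_le {n : ℕ} (h3 : 3 ≤ p) (h0 : n ≠ 0) (h1 : n ≠ 1) (hnp : n ≠ p) :
    (padicValNat p n : ℝ) + 1 / ((p : ℝ) - 1) ≤ 5 / (6 * (p : ℝ)) * n := by
  have hp3 : (3 : ℝ) ≤ p := by exact_mod_cast h3
  have hp1 : (0 : ℝ) < (p : ℝ) - 1 := by linarith
  have hinv : 1 / ((p : ℝ) - 1) ≤ 1 / 2 := by
    rw [div_le_div_iff₀ hp1 (by norm_num)]; linarith
  obtain ⟨m, hm⟩ : p ^ padicValNat p n ∣ n := pow_padicValNat_dvd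
  rcases hv : padicValNat p n with _ | _ | v
  · have : (2 : ℝ) ≤ n := by exact_mod_cast (by omega : 2 ≤ n)
    have h4 : 1 / ((p : ℝ) - 1) ≤ 5 / (6 * (p : ℝ)) * 2 := by
      rw [div_mul_eq_mul_div, div_le_div_iff₀ hp1 (by linarith)]; linarith
    have h5 : 5 / (6 * (p : ℝ)) * 2 ≤ 5 / (6 * (p : ℝ)) * n := by gcongr
    push_cast
    linarith
  · rw [hv, zero_add, pow_one] at hm
    have h2m : 2 ≤ m := by
      rcases m with _ | _ | m
      · omega
      · simp at hm; omega
      · omega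
    have : (2 : ℝ) ≤ m := by exact_mod_cast h2m
    have h5 : 5 / (6 * (p : ℝ)) * n = 5 / 6 * m := by
      rw [hm]; push_cast; field_simp
    rw [h5]; push_cast
    linarith
  · rw [hv, pow_succ] at hm
    have hm1 : 1 ≤ m := by
      rcases m with _ | m
      · omega
      · omega
    have h5 : 5 / (6 * (p : ℝ)) * n = 5 / 6 * ((p : ℝ) ^ (v + 1) * m) := by
      
      have hm' := congrArg (Nat.cast (R := ℝ)) hm
      push_cast at hm'
      rw [hm']; field_simp
    have h6 : (v : ℝ) * 3 + 3 ≤ (3 : ℝ) ^ (v + 1) := by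
      have h7 : ∀ w : ℕ, w * 3 + 3 ≤ 3 ^ (w + 1) := by
        intro w
        induction w with
        | zero => norm_num
        | succ w ih => rw [pow_succ]; omega
      exact_mod_cast h7 v
    have h7 : (3 : ℝ) ^ (v + 1) ≤ (p : ℝ) ^ (v + 1) := by gcongr
    have h8 : (p : ℝ) ^ (v + 1) * 1 ≤ (p : ℝ) ^ (v + 1) * m := by
      gcongr; exact_mod_cast hm1
    rw [h5]; push_cast
    have : (0 : ℝ) ≤ v := v.cast_nonneg
    linarith

/-- The growth rate that bounds the coefficients of Dwork's power series. -/
def dworkRate : ℝ := (p : ℝ) ^ (5 / (6 * (p : ℝ)))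

theorem one_le_dworkRate : 1 ≤ dworkRate p :=
  Real.one_le_rpow (by exact_mod_cast hp.out.one_le) (by positivity)

theorem dworkRate_pow_self : dworkRate p ^ p = (p : ℝ) ^ (5 / 6 : ℝ) := by
  have : (p : ℝ) ≠ 0 := Nat.cast_ne_zero.2 hp.out.ne_zero
  rw [dworkRate, ← Real.rpow_natCast, ← Real.rpow_mul (Nat.cast_nonneg p)]
  congr 1
  field_simp

/-- What convergence needs from the rate is that the exponent `5/6` is less than `1`. -/
theorem dworkRate_pow_lt : dworkRate p ^ p < p := by
  rw [dworkRate_pow_self]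
  conv_rhs => rw [← Real.rpow_one (p : ℝ)]
  exact Real.rpow_lt_rpow_of_exponent_lt (by exact_mod_cast hp.out.one_lt) (by norm_num)

/-- The series `-∑ X ^ n / n` over `n ≠ 0, 1, p`; its exponential is `(1 - X) exp (X + X ^ p / p)`. -/
def negLogTail : ℚ_[p]⟦X⟧ :=
  PowerSeries.mk fun n => if n = 0 ∨ n = 1 ∨ n = p then 0 else -(n : ℚ_[p])⁻¹

theorem derivative_negLogTail :
    d⁄dX ℚ_[p] (negLogTail p) = 1 + X ^ (p - 1) - PowerSeries.mk 1 := by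
  ext n
  have := hp.out.two_le
  rw [coeff_derivative, negLogTail, coeff_mk, map_sub, map_add, coeff_one, coeff_X_pow, coeff_mk]
  by_cases h0 : n = 0
  · subst h0
    rw [if_pos (by simp), if_pos rfl, if_neg (by omega)]; simp
  · by_cases h1 : n = p - 1
    · rw [if_pos (by omega), if_neg h0, if_pos h1]; simp
    · rw [if_neg (by omega), if_neg h0, if_neg h1]
      have : ((n : ℚ_[p]) + 1) ≠ 0 := by exact_mod_cast n.succ_ne_zero
      push_cast
      rw [neg_mul, inv_mul_cancel₀ this]; simp

theorem hasSubst_negLogTail : HasSubst (negLogTail p) :=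
  HasSubst.of_constantCoeff_zero' (by
    rw [← coeff_zero_eq_constantCoeff_apply, negLogTail, coeff_mk, if_pos (by simp)])

/-- Since `1 - X = exp(-∑ X^n/n)`, multiplying by `exp(X + X^p/p)` cancels the terms `n = 1` and `n
= p`. Formally, both sides solve the same differential equation with the same constant term. -/
theorem one_sub_X_mul_dworkExp :
    (1 - X) * dworkExp p = (exp ℚ_[p]).subst (negLogTail p) := by
  have hs := hasSubst_negLogTail p
  rw [← sub_eq_zero]
  refine eq_zero_of_derivative_eq_mul (g := d⁄dX ℚ_[p] (negLogTail p)) ?_ ?_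
  · have h := mk_one_mul_one_sub_eq_one ℚ_[p]
    rw [map_sub, derivative_subst hs, derivative_exp, Derivation.leibniz, map_sub, derivative_X,
      derivative_one, derivative_dworkExp, derivative_negLogTail, smul_eq_mul, smul_eq_mul]
    linear_combination dworkExp p * h
  · rw [map_sub, map_mul, constantCoeff_dworkExp]
    have : constantCoeff ((exp ℚ_[p]).subst (negLogTail p)) = 1 := by
      rw [← coeff_zero_eq_constantCoeff_apply, coeff_subst' hs, finsum_eq_single _ 0]
      · simp
      · intro k hk
        rw [coeff_zero_eq_constantCoeff_apply, map_pow, ← coeff_zero_eq_constantCoeff_apply,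
          negLogTail, coeff_mk, if_pos (by simp), zero_pow hk, smul_zero]
    rw [this]; simp

theorem norm_coeff_negLogTail_le (h3 : 3 ≤ p) (n : ℕ) :
    ‖coeff n (negLogTail p)‖ ≤ ((p : ℝ) ^ (1 / ((p : ℝ) - 1)))⁻¹ * dworkRate p ^ n := by
  have hp0 : (0 : ℝ) < p := by exact_mod_cast hp.out.pos
  rw [negLogTail, coeff_mk]
  split_ifs with h
  · rw [norm_zero]
    have := one_le_dworkRate p
    positivity
  · push Not at h
    rw [norm_neg, norm_inv, norm_natCast_eq_rpow p h.1, ← Real.rpow_neg hp0.le, dworkRate,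
      ← Real.rpow_natCast, ← Real.rpow_mul hp0.le, ← Real.rpow_add hp0]
    refine Real.rpow_le_rpow_of_exponent_le (by exact_mod_cast hp.out.one_le) ?_
    linarith [padicValNat_add_le p h3 h.1 h.2.1 h.2.2]

theorem norm_dworkCoeff_le (h3 : 3 ≤ p) (n : ℕ) : ‖dworkCoeff p n‖ ≤ dworkRate p ^ n := by
  have hR := one_le_dworkRate p
  have hc : (0 : ℝ) < (p : ℝ) ^ (1 / ((p : ℝ) - 1)) := by positivity
  -- The factor `p^(-1/(p-1))` in the bound for the tail is raised to the power `k` and cancels the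
  -- growth `p^(k/(p-1))` of `1/k!`.
  have hexp : ∀ n, ‖coeff n ((exp ℚ_[p]).subst (negLogTail p))‖ ≤ 1 * dworkRate p ^ n := by
    intro n
    rw [coeff_subst' (hasSubst_negLogTail p), finsum_eq_sum _
      (coeff_subst_finite' (hasSubst_negLogTail p) _ _)]
    refine IsUltrametricDist.norm_sum_le_of_forall_le_of_nonneg (by positivity) fun k _ => ?_
    have h1 := norm_coeff_pow_le (inv_nonneg.2 hc.le) (by linarith)
      (norm_coeff_negLogTail_le p h3) k n
    have h2 := norm_factorial_inv_le p k
    rw [smul_eq_mul, norm_mul, coeff_exp]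
    have h4 : ‖(algebraMap ℚ ℚ_[p]) (1 / (k.factorial : ℚ))‖ =
        ‖((k.factorial : ℕ) : ℚ_[p])‖⁻¹ := by simp
    rw [h4]
    calc _ ≤ ((p : ℝ) ^ (1 / ((p : ℝ) - 1))) ^ k *
          (((p : ℝ) ^ (1 / ((p : ℝ) - 1)))⁻¹ ^ k * dworkRate p ^ n) :=
          mul_le_mul h2 h1 (norm_nonneg _) (by positivity)
      _ = 1 * dworkRate p ^ n := by
          rw [← mul_assoc, ← mul_pow, mul_inv_cancel₀ hc.ne', one_pow]
  have hgeom : ∀ n, ‖coeff n (PowerSeries.mk 1 : ℚ_[p]⟦X⟧)‖ ≤ 1 * dworkRate p ^ n := by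
    intro n
    simpa using one_le_pow₀ hR
  -- Dividing by `1 - X` does no harm: the geometric series has coefficients `1`, and the rate is at
  -- least `1`.
  have key : dworkExp p = PowerSeries.mk 1 * (exp ℚ_[p]).subst (negLogTail p) := by
    rw [← one_sub_X_mul_dworkExp, ← mul_assoc, mk_one_mul_one_sub_eq_one, one_mul]
  rw [dworkCoeff, key]
  simpa using norm_coeff_mul_le zero_le_one zero_le_one (by linarith) hgeom hexp n

end Bound

/-- The series `∑ e (b + p l) p ^ l y (y + 1) ⋯ (y + l - 1)` for `y ∈ ℤ_p`, where `e n` are the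
coefficients of Dwork's power series. -/
def dworkSum (b : ℕ) (y : ℤ_[p]) : ℚ_[p] :=
  ∑' l : ℕ, dworkCoeff p (b + p * l) * (p : ℚ_[p]) ^ l * ((ascPochhammer ℤ_[p] l).eval y : ℤ_[p])

/-! ### Convergence and continuity of Dwork's sums -/

section Convergence

theorem norm_dworkSum_term_le (h3 : 3 ≤ p) (b l : ℕ) (y : ℤ_[p]) :
    ‖dworkCoeff p (b + p * l) * (p : ℚ_[p]) ^ l * ((ascPochhammer ℤ_[p] l).eval y : ℤ_[p])‖ ≤
      dworkRate p ^ b * (dworkRate p ^ p / p) ^ l := by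
  have hR : 0 ≤ dworkRate p := zero_le_one.trans (one_le_dworkRate p)
  rw [norm_mul, norm_mul, norm_pow, Padic.norm_p]
  have h1 := norm_dworkCoeff_le p h3 (b + p * l)
  have h2 : ‖(((ascPochhammer ℤ_[p] l).eval y : ℤ_[p]) : ℚ_[p])‖ ≤ 1 := PadicInt.norm_le_one _
  calc _ ≤ dworkRate p ^ (b + p * l) * (p : ℝ)⁻¹ ^ l * 1 := by gcongr
    _ = _ := by rw [mul_one, pow_add, pow_mul, div_pow, inv_pow, mul_assoc, div_eq_mul_inv]

theorem dworkRate_ratio_nonneg : 0 ≤ dworkRate p ^ p / p := by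
  have := one_le_dworkRate p
  positivity

theorem dworkRate_ratio_lt_one : dworkRate p ^ p / p < 1 := by
  rw [div_lt_one (by exact_mod_cast hp.out.pos)]
  exact dworkRate_pow_lt p

theorem summable_dworkSum_bound (b : ℕ) :
    Summable fun l : ℕ => dworkRate p ^ b * (dworkRate p ^ p / p) ^ l :=
  (summable_geometric_of_lt_one (dworkRate_ratio_nonneg p) (dworkRate_ratio_lt_one p)).mul_left _

theorem summable_dworkSum (h3 : 3 ≤ p) (b : ℕ) (y : ℤ_[p]) :
    Summable fun l : ℕ => dworkCoeff p (b + p * l) * (p : ℚ_[p]) ^ l *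
      ((ascPochhammer ℤ_[p] l).eval y : ℤ_[p]) :=
  (summable_dworkSum_bound p b).of_norm_bounded (norm_dworkSum_term_le p h3 b · y)

theorem continuous_dworkSum (h3 : 3 ≤ p) (b : ℕ) : Continuous (dworkSum p b) :=
  continuous_tsum (fun l => continuous_const.mul
      (continuous_subtype_val.comp (ascPochhammer ℤ_[p] l).continuous))
    (summable_dworkSum_bound p b) (fun l y => norm_dworkSum_term_le p h3 b l y)

theorem norm_dworkSum_le (h3 : 3 ≤ p) (b : ℕ) (y : ℤ_[p]) :
    ‖dworkSum p b y‖ ≤ dworkRate p ^ b := by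
  have := one_le_dworkRate p
  refine IsUltrametricDist.norm_tsum_le_of_forall_le_of_nonneg (by positivity) fun l => ?_
  refine (norm_dworkSum_term_le p h3 b l y).trans ?_
  exact mul_le_of_le_one_right (by positivity)
    (pow_le_one₀ (dworkRate_ratio_nonneg p) (dworkRate_ratio_lt_one p).le)

end Convergence

/-! ### Morita's gamma function as the inverse of a Dwork sum -/

section GammaValue

theorem coeff_mul_expand {R : Type*} [CommRing R] {q : ℕ} (hq : q ≠ 0) {a : ℕ} (ha : a < q) (m : ℕ)
    (f g : R⟦X⟧) : coeff (a + q * m) (f * expand q hq g) =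
      ∑ l ∈ Finset.range (m + 1), coeff (a + q * l) f * coeff (m - l) g := by
  rw [coeff_mul]
  symm
  refine Finset.sum_of_injOn (fun l => (a + q * l, q * (m - l))) ?_ ?_ ?_ ?_
  · intro x _ y _ hxy
    have := (Prod.mk.inj hxy).1
    exact Nat.eq_of_mul_eq_mul_left (Nat.pos_of_ne_zero hq) (by omega)
  · intro l hl
    have hl : l < m + 1 := by simpa using hl
    simp only [SetLike.mem_coe, Finset.HasAntidiagonal.mem_antidiagonal]
    rw [add_assoc, ← mul_add]
    congr 2
    omega
  · rintro ⟨i, j⟩ hij hn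
    rw [Finset.HasAntidiagonal.mem_antidiagonal] at hij
    simp only at hij ⊢
    rw [coeff_expand, if_neg, mul_zero]
    rintro ⟨k, rfl⟩
    apply hn
    have hk : k ≤ m := by
      by_contra h
      have : q * (m + 1) ≤ q * k := Nat.mul_le_mul_left q (by omega)
      rw [mul_add] at this
      omega
    obtain ⟨d, rfl⟩ := Nat.exists_eq_add_of_le hk
    refine ⟨d, by simp, ?_⟩
    rw [mul_add] at hij
    simp only [Prod.mk.injEq]
    exact ⟨by omega, by congr 1; omega⟩
  · intro l _
    rw [coeff_expand_mul]

/-- At `y = -m` the rising factorial of length `l` vanishes for `l > m`. The remaining finite sum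
is, up to the factor `(-p)^m m!`, the coefficient of `X^(a+pm)` in `exp(X) = E · exp(-X^p/p)`,
namely `1/(a+pm)!`. -/
theorem dworkSum_neg_natCast {a : ℕ} (ha : a < p) (m : ℕ) :
    dworkSum p a (-(m : ℤ_[p])) * ((a + p * m).factorial : ℕ) =
      (-(p : ℚ_[p])) ^ m * (m.factorial : ℕ) := by
  have hp0 := natCast_prime_ne_zero p
  have hasc : ∀ l : ℕ, (((ascPochhammer ℤ_[p] l).eval (-(m : ℤ_[p])) : ℤ_[p]) : ℚ_[p]) =
      (-1) ^ l * (m.descFactorial l : ℕ) := by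
    intro l
    rw [ascPochhammer_eval_neg_eq_descPochhammer, descPochhammer_eval_eq_descFactorial]
    push_cast
    rfl
  have h := congrArg (coeff (a + p * m)) (exp_eq_dworkExp_mul p)
  rw [coeff_mul_expand hp.out.ne_zero ha, coeff_exp] at h
  have hf : (((a + p * m).factorial : ℕ) : ℚ_[p]) ≠ 0 := Nat.cast_ne_zero.2 (Nat.factorial_ne_zero _)
  have h1 : dworkSum p a (-(m : ℤ_[p])) = (-(p : ℚ_[p])) ^ m * (m.factorial : ℕ) *
      (algebraMap ℚ ℚ_[p]) (1 / ((a + p * m).factorial : ℕ)) := by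
    rw [h, dworkSum, tsum_eq_sum (s := Finset.range (m + 1)), Finset.mul_sum]
    · refine Finset.sum_congr rfl fun l hl => ?_
      have hl : l ≤ m := by have := Finset.mem_range.1 hl; omega
      obtain ⟨k, rfl⟩ := Nat.exists_eq_add_of_le hl
      have hk : ((k.factorial : ℕ) : ℚ_[p]) ≠ 0 := Nat.cast_ne_zero.2 (Nat.factorial_ne_zero _)
      have h2 := Nat.factorial_mul_descFactorial hl
      rw [hasc, coeff_rescale, coeff_exp, dworkCoeff, ← h2]
      rw [Nat.add_sub_cancel_left]
      simp only [one_div, map_inv₀, map_natCast, Nat.cast_mul]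
      have h3 : (-(p : ℚ_[p])) ^ (l + k) * (-(p : ℚ_[p])⁻¹) ^ k = (-1) ^ l * (p : ℚ_[p]) ^ l := by
        rw [pow_add, mul_assoc, ← mul_pow, neg_mul_neg, mul_inv_cancel₀ hp0, one_pow, mul_one,
          neg_pow]
      field_simp
      linear_combination (-(coeff (a + p * l)) (dworkExp p)) * h3
    · intro l hl
      rw [hasc, Nat.descFactorial_of_lt (by simpa using hl)]
      simp
  rw [h1]
  simp only [one_div, map_inv₀, map_natCast]
  field_simp

/-- The multiples of `q` up to `N` contribute `q^⌊N/q⌋ ⌊N/q⌋!` to `N!`; the filtered product is what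
remains. -/
theorem prod_filter_not_dvd_mul (q N : ℕ) (hq : 0 < q) :
    (∏ j ∈ (Finset.Ioo 0 (N + 1)).filter (fun j => ¬ q ∣ j), j) * (q ^ (N / q) * (N / q).factorial)
      = N.factorial := by
  induction N with
  | zero =>
    rw [Finset.prod_eq_one fun j hj => ?_]
    · simp
    · have := Finset.mem_Ioo.1 (Finset.mem_filter.1 hj).1
      omega
  | succ N ih =>
    have hI : Finset.Ioo 0 (N + 1 + 1) = insert (N + 1) (Finset.Ioo 0 (N + 1)) := by
      
      ext j
      rw [Finset.mem_insert, Finset.mem_Ioo, Finset.mem_Ioo]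
      omega
    rw [hI, Finset.filter_insert, Nat.succ_div]
    by_cases h : q ∣ N + 1
    · rw [if_neg (not_not.2 h), if_pos h, Nat.factorial_succ N, ← ih, Nat.factorial_succ, pow_succ]
      have : N + 1 = q * (N / q + 1) := by
        obtain ⟨k, hk⟩ := h
        have h2 := Nat.succ_div_of_dvd (a := N) (b := q) ⟨k, hk⟩
        rw [hk, Nat.mul_div_cancel_left _ hq] at h2
        rw [hk, h2]
      generalize ∏ j ∈ (Finset.Ioo 0 (N + 1)).filter (fun j => ¬ q ∣ j), j = A
      rw [this]
      ring
    · rw [if_pos h, if_neg h, Finset.prod_insert (by simp), add_zero, mul_assoc, ih,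
        Nat.factorial_succ]

theorem gammaNat_mul_dworkSum (h2 : p ≠ 2) {a : ℕ} (ha : a < p) (m : ℕ) :
    ((gammaNat p (1 + a + p * m) : ℤ_[p]) : ℚ_[p]) *
      ((-1) ^ (a + 1) * dworkSum p a (-(m : ℤ_[p]))) = 1 := by
  have hodd : Odd p := hp.out.odd_of_ne_two h2
  have h1 := prod_filter_not_dvd_mul p (a + p * m) hp.out.pos
  have hdiv : (a + p * m) / p = m := by
    rw [Nat.add_mul_div_left _ _ hp.out.pos, Nat.div_eq_of_lt ha, zero_add]
  rw [hdiv] at h1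
  have h3 := dworkSum_neg_natCast p ha m
  have hf : (((a + p * m).factorial : ℕ) : ℚ_[p]) ≠ 0 := Nat.cast_ne_zero.2 (Nat.factorial_ne_zero _)
  have hgam : ((gammaNat p (1 + a + p * m) : ℤ_[p]) : ℚ_[p]) = (-1) ^ (1 + a + p * m) *
      ((∏ j ∈ (Finset.Ioo 0 (a + p * m + 1)).filter (fun j => ¬ p ∣ j), j : ℕ) : ℚ_[p]) := by
    rw [gammaNat, show 1 + a + p * m = a + p * m + 1 by ring]
    push_cast
    congr 1
    exact (map_prod (PadicInt.Coe.ringHom (p := p)) _ _).trans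
      (Finset.prod_congr rfl fun j _ => map_natCast _ j)
  have hsign : (-1 : ℚ_[p]) ^ (1 + a + p * m) * (-1) ^ (a + 1) = (-1) ^ m := by
    rw [pow_add, pow_mul, hodd.neg_one_pow, mul_right_comm, ← pow_add,
      show 1 + a + (a + 1) = 2 * (a + 1) by ring, pow_mul]
    simp
  have h1' := congrArg (Nat.cast (R := ℚ_[p])) h1
  rw [Nat.cast_mul, Nat.cast_mul, Nat.cast_pow] at h1'
  rw [hgam]
  apply mul_right_cancel₀ hf
  set P := ((∏ j ∈ (Finset.Ioo 0 (a + p * m + 1)).filter (fun j => ¬ p ∣ j), j : ℕ) : ℚ_[p])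
  have hm1 : (-1 : ℚ_[p]) ^ m * (-1) ^ m = 1 := by rw [← mul_pow]; simp
  calc _ = ((-1 : ℚ_[p]) ^ (1 + a + p * m) * (-1) ^ (a + 1)) * P *
        (dworkSum p a (-(m : ℤ_[p])) * ((a + p * m).factorial : ℕ)) := by ring
    _ = ((-1 : ℚ_[p]) ^ m * (-1) ^ m) * (P * ((p : ℚ_[p]) ^ m * (m.factorial : ℕ))) := by
        rw [hsign, h3, neg_pow]; ring
    _ = _ := by rw [hm1, h1']

/-- At `z = -m` the sum is, up to sign, the inverse of a `p`-adic integer. The points `-m` are dense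
and the condition is closed, so the bound holds everywhere. It allows the sum to be inverted in the
limit. -/
theorem one_le_norm_dworkSum (h2 : p ≠ 2) {a : ℕ} (ha : a < p) (z : ℤ_[p]) :
    1 ≤ ‖dworkSum p a z‖ := by
  have h3 : 3 ≤ p := by have := hp.out.two_le; omega
  have hd : DenseRange fun m : ℕ => -(m : ℤ_[p]) :=
    (Homeomorph.neg ℤ_[p]).surjective.denseRange.comp PadicInt.denseRange_natCast continuous_neg
  refine hd.induction_on (p := fun z => 1 ≤ ‖dworkSum p a z‖) z
    (isClosed_le continuous_const (continuous_dworkSum p h3 a).norm) fun m => ?_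
  have h := congrArg norm (gammaNat_mul_dworkSum p h2 ha m)
  rw [norm_mul, norm_mul, norm_pow, norm_neg, norm_one, one_pow, one_mul] at h
  have hg : ‖((gammaNat p (1 + a + p * m) : ℤ_[p]) : ℚ_[p])‖ ≤ 1 := PadicInt.norm_le_one _
  rw [← h]
  exact mul_le_of_le_one_left (norm_nonneg _) hg

/-- Density of `ℕ` in `ℤ_p` gives natural numbers near `x`, and `x ≠ 0` excludes `0` from a
neighbourhood. Nontriviality of the filter makes the limit defining `gamma` unique. -/
theorem neBot_natCast_positive {x : ℤ_[p]} (hx : x ≠ 0) :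
    (comap (fun n : ℕ => (n : ℤ_[p])) (𝓝 x) ⊓ 𝓟 {n : ℕ | 0 < n}).NeBot := by
  have h1 : (comap (fun n : ℕ => (n : ℤ_[p])) (𝓝 x)).NeBot := by
    rw [comap_neBot_iff_frequently]
    have := PadicInt.denseRange_natCast (p := p) x
    exact mem_closure_iff_frequently.1 this
  have h2 : {n : ℕ | 0 < n} ∈ comap (fun n : ℕ => (n : ℤ_[p])) (𝓝 x) := by
    refine mem_comap.2 ⟨{0}ᶜ, isOpen_compl_singleton.mem_nhds hx, fun n hn => ?_⟩
    rcases n.eq_zero_or_pos with rfl | h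
    · simp at hn
    · exact h
  rwa [inf_eq_left.2 (le_principal_iff.2 h2)]

/-- Dwork's formula for Morita's `p`-adic gamma function. -/
theorem gamma_eq_inv_dworkSum (h2 : p ≠ 2) {a : ℕ} (ha : a + 1 < p) (z : ℤ_[p]) {x : ℤ_[p]}
    (hx : x = 1 + a - p * z) (hx0 : x ≠ 0) :
    ((gamma p x : ℤ_[p]) : ℚ_[p]) = ((-1) ^ (a + 1) * dworkSum p a z)⁻¹ := by
  have h3 : 3 ≤ p := by have := hp.out.two_le; omega
  have ha' : a < p := by omega
  set l := comap (fun n : ℕ => (n : ℤ_[p])) (𝓝 x) ⊓ 𝓟 {n : ℕ | 0 < n} with hl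
  have : l.NeBot := neBot_natCast_positive p hx0
  have hlx : Tendsto (fun n : ℕ => (n : ℤ_[p])) l (𝓝 x) := tendsto_comap.mono_left inf_le_left
  have hnorm : ‖((-1) ^ (a + 1) * dworkSum p a z)⁻¹‖ ≤ 1 := by
    rw [norm_inv, norm_mul, norm_pow, norm_neg, norm_one, one_pow, one_mul]
    exact inv_le_one_of_one_le₀ (one_le_norm_dworkSum p h2 ha' z)
  -- Integers close to `x` are congruent to `1 + a` mod `p`, hence of the form `1 + a + p m`; then
  -- `-m` tends to `z`.
  have hev : ∀ᶠ n : ℕ in l, n = 1 + a + p * ((n - (1 + a)) / p) := by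
    have h4 : ∀ᶠ n : ℕ in l, ‖(n : ℤ_[p]) - x‖ < 1 := by
      have := hlx.eventually (Metric.ball_mem_nhds x one_pos)
      simpa [dist_eq_norm] using this
    filter_upwards [h4] with n hn
    have h5 : ‖(((n : ℤ) - (1 + a : ℤ) : ℤ) : ℤ_[p])‖ < 1 := by
      have : (((n : ℤ) - (1 + a : ℤ) : ℤ) : ℤ_[p]) = ((n : ℤ_[p]) - x) + (-(p * z)) := by
        rw [hx]; push_cast; ring
      rw [this]
      refine (IsUltrametricDist.norm_add_le_max _ _).trans_lt (max_lt hn ?_)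
      rw [norm_neg, norm_mul, PadicInt.norm_p]
      have hp1 : (1 : ℝ) < p := by exact_mod_cast hp.out.one_lt
      calc (p : ℝ)⁻¹ * ‖z‖ ≤ (p : ℝ)⁻¹ * 1 := by gcongr; exact PadicInt.norm_le_one z
        _ < 1 := by rw [mul_one]; exact inv_lt_one_of_one_lt₀ hp1
    rw [PadicInt.norm_intCast_lt_one_iff] at h5
    obtain ⟨k, hk⟩ := h5
    -- A negative `k` would give `n ≤ 1 + a - p < 0`; this is where `a + 1 < p` enters. It follows
    -- that the truncated subtraction `n - (1 + a)` is exact.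
    have hk0 : 0 ≤ k := by
      by_contra hneg
      have : (p : ℤ) * k ≤ p * (-1) := by gcongr; omega
      omega
    have h6 : n - (1 + a) = p * k.toNat := by
      zify [show 1 + a ≤ n by have : 0 ≤ (p : ℤ) * k := by positivity
                              omega]
      rw [Int.toNat_of_nonneg hk0]; exact hk
    have h7 : (n : ℤ) = 1 + a + p * k := by linarith
    rw [h6, Nat.mul_div_cancel_left _ hp.out.pos]
    zify
    rw [Int.toNat_of_nonneg hk0]; exact h7
  have hm : Tendsto (fun n : ℕ => -(((n - (1 + a)) / p : ℕ) : ℤ_[p])) l (𝓝 z) := by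
    rw [tendsto_iff_norm_sub_tendsto_zero] at hlx ⊢
    have h4 : Tendsto (fun n : ℕ => (p : ℝ) * ‖(n : ℤ_[p]) - x‖) l (𝓝 0) := by
      simpa using hlx.const_mul (p : ℝ)
    refine h4.congr' ?_
    filter_upwards [hev] with n hn
    have h5 : (n : ℤ_[p]) - x = -(p * (-(((n - (1 + a)) / p : ℕ) : ℤ_[p]) - z)) := by
      have := congrArg (Nat.cast (R := ℤ_[p])) hn
      push_cast at this
      rw [hx]
      linear_combination this
    have hp1 : (p : ℝ) ≠ 0 := Nat.cast_ne_zero.2 hp.out.ne_zero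
    rw [h5, norm_neg, norm_mul, PadicInt.norm_p, mul_inv_cancel_left₀ hp1]
  have hne : (-1) ^ (a + 1) * dworkSum p a z ≠ 0 := by
    refine mul_ne_zero (by simp) fun h => ?_
    have := one_le_norm_dworkSum p h2 ha' z
    rw [h, norm_zero] at this
    linarith
  have hlim : Tendsto (fun n => ((gammaNat p n : ℤ_[p]) : ℚ_[p])) l
      (𝓝 ((-1) ^ (a + 1) * dworkSum p a z)⁻¹) := by
    have h4 := ((((continuous_dworkSum p h3 a).tendsto z).comp hm).const_mul
      ((-1 : ℚ_[p]) ^ (a + 1))).inv₀ hne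
    refine h4.congr' ?_
    filter_upwards [hev] with n hn
    rw [Function.comp_apply]
    refine (eq_inv_of_mul_eq_one_left ?_).symm
    nth_rewrite 1 [hn]
    exact gammaNat_mul_dworkSum p h2 ha' _
  have hlim' : Tendsto (gammaNat p) l (𝓝 (⟨_, hnorm⟩ : ℤ_[p])) := tendsto_subtype_rng.2 hlim
  rw [gamma, if_neg hx0, ← hl, hlim'.limUnder_eq]

end GammaValue

/-! ### From Dwork's sum to an arithmetic progression of coefficients -/

section TraceFormula

/-- When `b = (p-1) y`, the recursion for the coefficients combines with the two recursions of the
rising factorial, and all terms cancel except the one with index `0`. Iterating this relation gives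
the trace formula. -/
theorem dworkSum_succ (h3 : 3 ≤ p) {b : ℕ} {y : ℤ_[p]} (hy : (b : ℤ_[p]) = (p - 1) * y) :
    -(p : ℚ_[p]) * dworkSum p (b + (p - 1)) (y + 1) =
      dworkSum p b y - (1 - p) * dworkCoeff p b := by
  have hy' : (b : ℚ_[p]) = (p - 1) * (y : ℚ_[p]) := by
    have := congrArg (fun t : ℤ_[p] => (t : ℚ_[p])) hy
    simpa using this
  set u : ℕ → ℚ_[p] := fun n => dworkCoeff p (b + p * n) with hu
  set P : ℕ → ℚ_[p] := fun n => ((ascPochhammer ℤ_[p] n).eval (y + 1) : ℤ_[p]) with hP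
  have hPr : ∀ n, P (n + 1) = P n * (y + 1 + n) := by
    intro n
    simp only [hP]
    rw [ascPochhammer_succ_eval]
    push_cast
    rfl
  set Q : ℕ → ℚ_[p] := fun n => ((ascPochhammer ℤ_[p] n).eval y : ℤ_[p]) with hQ
  have hPl : ∀ n, Q (n + 1) = y * P n := by
    intro n
    simp only [hP, hQ]
    rw [ascPochhammer_succ_left]
    simp
  -- With `N = b + (p-1) + pn`, the hypothesis on `b` turns the factor `N + 1` into `p(y+1+n) - y`.
  -- The first part extends the rising factorial of `y + 1` on the right, the second extends it on
  -- the left to that of `y`.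
  have hrec : ∀ n, dworkCoeff p (b + (p - 1) + p * n) =
      ((p : ℚ_[p]) * (y + 1 + n) - y) * u (n + 1) - u n := by
    intro n
    have h := succ_mul_dworkCoeff p (b + (p - 1) + p * n)
    have := hp.out.pos
    have h1 : b + (p - 1) + p * n + 1 = b + p * (n + 1) := by rw [mul_add]; omega
    have h2 : b + p * (n + 1) - p = b + p * n := by rw [mul_add]; omega
    have h4 : ((b + (p - 1) + p * n : ℕ) : ℚ_[p]) + 1 = p * (y + 1 + n) - y := by
      have := congrArg (Nat.cast (R := ℚ_[p])) h1
      push_cast at this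
      push_cast
      rw [this, hy']; ring
    rw [h4, h1, if_pos (by nlinarith), h2] at h
    simp only [hu]
    linear_combination -h
  have hs : Summable fun n => u n * (p : ℚ_[p]) ^ n * Q n := summable_dworkSum p h3 b y
  have hs1 : Summable fun n => dworkCoeff p (b + (p - 1) + p * n) * (p : ℚ_[p]) ^ n * P n :=
    summable_dworkSum p h3 (b + (p - 1)) (y + 1)
  have hs2 : Summable fun n => u n * (p : ℚ_[p]) ^ n * P n := summable_dworkSum p h3 b (y + 1)
  have hS0 : dworkSum p b y = ∑' n, u n * (p : ℚ_[p]) ^ n * Q n := rfl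
  have hS1 : dworkSum p (b + (p - 1)) (y + 1) =
    ∑' n, dworkCoeff p (b + (p - 1) + p * n) * (p : ℚ_[p]) ^ n * P n := rfl
  have hu0 : u 0 = dworkCoeff p b := by simp [hu]
  have hP0 : P 0 = 1 := by simp [hP]
  have hQ0 : Q 0 = 1 := by simp [hQ]
  rw [hS0, hS1, ← hu0]
  clear_value u P Q
  have hS : ∑' n, u n * (p : ℚ_[p]) ^ n * Q n =
      u 0 + ∑' n, u (n + 1) * (p : ℚ_[p]) ^ (n + 1) * (y * P n) := by
    rw [hs.tsum_eq_zero_add]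
    simp [hPl, hQ0]
  have hT : ∑' n, u n * (p : ℚ_[p]) ^ n * P n =
      u 0 + ∑' n, u (n + 1) * (p : ℚ_[p]) ^ (n + 1) * P (n + 1) := by
    rw [hs2.tsum_eq_zero_add]
    simp [hP0]
  have hs' : Summable fun n => u (n + 1) * (p : ℚ_[p]) ^ (n + 1) * (y * P n) := by
    simpa only [hPl] using (summable_nat_add_iff 1).2 hs
  have hs2' : Summable fun n => u (n + 1) * (p : ℚ_[p]) ^ (n + 1) * P (n + 1) :=
    (summable_nat_add_iff 1).2 hs2
  have hterm : ∀ n, (p : ℚ_[p]) * (dworkCoeff p (b + (p - 1) + p * n) * (p : ℚ_[p]) ^ n * P n) =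
      p * (u (n + 1) * (p : ℚ_[p]) ^ (n + 1) * P (n + 1)) -
        u (n + 1) * (p : ℚ_[p]) ^ (n + 1) * (y * P n) - p * (u n * (p : ℚ_[p]) ^ n * P n) := by
    intro n
    rw [hrec, hPr, pow_succ]
    ring
  have h1 := hs1.hasSum.mul_left (p : ℚ_[p])
  have h2 := ((hs2'.hasSum.mul_left (p : ℚ_[p])).sub hs'.hasSum).sub
    (hs2.hasSum.mul_left (p : ℚ_[p]))
  simp only [hterm] at h1
  have hfin := h1.unique h2
  linear_combination -hfin + p * hT - hS

/-- The trace formula: the value of Dwork's sum at `a / (p - 1)` is a sum of coefficients of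
Dwork's power series over a residue class modulo `p - 1`. -/
theorem hasSum_dworkCoeff_arith (h3 : 3 ≤ p) {a : ℕ} {z : ℤ_[p]}
    (hz : (a : ℤ_[p]) = (p - 1) * z) :
    HasSum (fun k : ℕ => (1 - (p : ℚ_[p])) * (dworkCoeff p (a + (p - 1) * k) * (-(p : ℚ_[p])) ^ k))
      (dworkSum p a z) := by
  have hR := one_le_dworkRate p
  have hp0 : (0 : ℝ) < p := by exact_mod_cast hp.out.pos
  have hrate : ∀ k, dworkRate p ^ (a + (p - 1) * k) * (p : ℝ)⁻¹ ^ k ≤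
      dworkRate p ^ a * (dworkRate p ^ p / p) ^ k := by
    intro k
    rw [pow_add, pow_mul, div_eq_mul_inv, mul_pow, mul_assoc]
    gcongr
    omega
  have hnormp : ∀ k, ‖(-(p : ℚ_[p])) ^ k‖ = (p : ℝ)⁻¹ ^ k := by
    intro k; rw [norm_pow, norm_neg, Padic.norm_p]
  have hsum : Summable fun k : ℕ =>
      (1 - (p : ℚ_[p])) * (dworkCoeff p (a + (p - 1) * k) * (-(p : ℚ_[p])) ^ k) := by
    refine Summable.mul_left _ ((summable_dworkSum_bound p a).of_norm_bounded fun k => ?_)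
    rw [norm_mul, hnormp]
    refine le_trans ?_ (hrate k)
    gcongr
    exact norm_dworkCoeff_le p h3 _
  -- Applying `dworkSum_succ` at `(a + (p-1)M, z + M)` splits off one coefficient at a time; the
  -- hypothesis `b = (p-1) y` persists along these pairs.
  have hpart : ∀ M : ℕ, ∑ k ∈ Finset.range M,
      (1 - (p : ℚ_[p])) * (dworkCoeff p (a + (p - 1) * k) * (-(p : ℚ_[p])) ^ k) =
      dworkSum p a z - (-(p : ℚ_[p])) ^ M * dworkSum p (a + (p - 1) * M) (z + M) := by
    intro M
    induction M with
    | zero => simp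
    | succ M ih =>
      have h := dworkSum_succ p h3 (b := a + (p - 1) * M) (y := z + M) (by
        rw [mul_add, ← hz]; push_cast [Nat.cast_sub hp.out.one_le]; ring)
      rw [Finset.sum_range_succ, ih, mul_add_one, ← add_assoc, Nat.cast_add_one, ← add_assoc,
        pow_succ]
      linear_combination (-(p : ℚ_[p])) ^ M * h
  have hrem : Tendsto (fun M : ℕ => (-(p : ℚ_[p])) ^ M * dworkSum p (a + (p - 1) * M) (z + M))
      atTop (𝓝 0) := by
    refine squeeze_zero_norm (fun M => ?_) (summable_dworkSum_bound p a).tendsto_atTop_zero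
    rw [norm_mul, hnormp, mul_comm]
    refine le_trans ?_ (hrate M)
    gcongr
    exact norm_dworkSum_le p h3 _ _
  have hlim : Tendsto (fun M : ℕ => ∑ k ∈ Finset.range M,
      (1 - (p : ℚ_[p])) * (dworkCoeff p (a + (p - 1) * k) * (-(p : ℚ_[p])) ^ k)) atTop
      (𝓝 (dworkSum p a z)) := by
    simp_rw [hpart]
    simpa using tendsto_const_nhds.sub hrem
  have := hsum.hasSum
  rwa [tendsto_nhds_unique this.tendsto_sum_nat hlim] at this

end TraceFormula

/-! ### Values of power series in a normed extension field -/

section Evaluation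

variable {F K : Type*} [NormedField F] [NormedField K] [NormedAlgebra F K]

/-- The value at `x` of a power series over a normed field, in a normed extension field. -/
def seriesValue (x : K) (f : F⟦X⟧) : K := ∑' n : ℕ, algebraMap F K (coeff n f) * x ^ n

/-- Absolute convergence of a power series at `x`. -/
def ConvergesAt (x : K) (f : F⟦X⟧) : Prop :=
  Summable fun n : ℕ => ‖algebraMap F K (coeff n f) * x ^ n‖

theorem map_coeff_mul_mul_pow (x : K) (f g : F⟦X⟧) (n : ℕ) :
    algebraMap F K (coeff n (f * g)) * x ^ n =
      ∑ kl ∈ Finset.HasAntidiagonal.antidiagonal n, (algebraMap F K (coeff kl.1 f) * x ^ kl.1) *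
        (algebraMap F K (coeff kl.2 g) * x ^ kl.2) := by
  rw [coeff_mul, map_sum, Finset.sum_mul]
  refine Finset.sum_congr rfl fun kl hkl => ?_
  rw [← Finset.HasAntidiagonal.mem_antidiagonal.1 hkl, map_mul, pow_add]
  ring

theorem ConvergesAt.mul {x : K} {f g : F⟦X⟧} (hf : ConvergesAt x f) (hg : ConvergesAt x g) :
    ConvergesAt x (f * g) := by
  simp only [ConvergesAt, map_coeff_mul_mul_pow]
  exact summable_norm_sum_mul_antidiagonal_of_summable_norm
    (f := fun n => algebraMap F K (coeff n f) * x ^ n)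
    (g := fun n => algebraMap F K (coeff n g) * x ^ n) hf hg

theorem convergesAt_one (x : K) : ConvergesAt x (1 : F⟦X⟧) := by
  refine summable_of_ne_finset_zero (s := {0}) fun n hn => ?_
  rw [coeff_one, if_neg (by simpa using hn)]
  simp

theorem seriesValue_one (x : K) : seriesValue x (1 : F⟦X⟧) = 1 := by
  rw [seriesValue, tsum_eq_single 0]
  · simp
  · intro n hn
    rw [coeff_one, if_neg hn]
    simp

theorem seriesValue_mul [CompleteSpace K] {x : K} {f g : F⟦X⟧} (hf : ConvergesAt x f)
    (hg : ConvergesAt x g) : seriesValue x (f * g) = seriesValue x f * seriesValue x g := by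
  simp only [seriesValue, map_coeff_mul_mul_pow]
  exact (tsum_mul_tsum_eq_tsum_sum_antidiagonal_of_summable_norm hf hg).symm

theorem ConvergesAt.pow {x : K} {f : F⟦X⟧} (hf : ConvergesAt x f) (k : ℕ) :
    ConvergesAt x (f ^ k) := by
  induction k with
  | zero => rw [pow_zero]; exact convergesAt_one x
  | succ k ih => rw [pow_succ]; exact ih.mul hf

theorem seriesValue_pow [CompleteSpace K] {x : K} {f : F⟦X⟧} (hf : ConvergesAt x f) (k : ℕ) :
    seriesValue x (f ^ k) = seriesValue x f ^ k := by
  induction k with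
  | zero => rw [pow_zero, pow_zero, seriesValue_one]
  | succ k ih => rw [pow_succ, pow_succ, seriesValue_mul (hf.pow k) hf, ih]

theorem expand_term_support {q : ℕ} (hq : q ≠ 0) (x : K) (f : F⟦X⟧) {n : ℕ}
    (hn : n ∉ Set.range fun k => q * k) :
    algebraMap F K (coeff n (expand q hq f)) * x ^ n = 0 := by
  rw [coeff_expand, if_neg, map_zero, zero_mul]
  rintro ⟨k, rfl⟩
  exact hn ⟨k, rfl⟩

theorem convergesAt_expand {q : ℕ} (hq : q ≠ 0) {x : K} {f : F⟦X⟧}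
    (h : ConvergesAt (x ^ q) f) : ConvergesAt x (expand q hq f) := by
  have hinj : Function.Injective fun k : ℕ => q * k :=
    fun a b hab => Nat.eq_of_mul_eq_mul_left (Nat.pos_of_ne_zero hq) hab
  refine (hinj.summable_iff fun n hn => ?_).1 ?_
  · rw [expand_term_support hq x f hn, norm_zero]
  · refine h.congr fun k => ?_
    simp only [Function.comp_apply]
    rw [coeff_expand_mul, pow_mul]

theorem seriesValue_expand {q : ℕ} (hq : q ≠ 0) (x : K) (f : F⟦X⟧) :
    seriesValue x (expand q hq f) = seriesValue (x ^ q) f := by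
  have hinj : Function.Injective fun k : ℕ => q * k :=
    fun a b hab => Nat.eq_of_mul_eq_mul_left (Nat.pos_of_ne_zero hq) hab
  rw [seriesValue, ← hinj.tsum_eq]
  · refine tsum_congr fun k => ?_
    rw [coeff_expand_mul, pow_mul]
  · intro n hn
    by_contra h
    exact hn (expand_term_support hq x f h)

theorem rescale_term (a : F) (x : K) (f : F⟦X⟧) (n : ℕ) :
    algebraMap F K (coeff n (rescale a f)) * x ^ n =
      algebraMap F K (coeff n f) * (algebraMap F K a * x) ^ n := by
  rw [coeff_rescale, map_mul, map_pow, mul_pow]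
  ring

theorem seriesValue_rescale (a : F) (x : K) (f : F⟦X⟧) :
    seriesValue x (rescale a f) = seriesValue (algebraMap F K a * x) f :=
  tsum_congr (rescale_term a x f)

theorem convergesAt_rescale {a : F} {x : K} {f : F⟦X⟧} (h : ConvergesAt (algebraMap F K a * x) f) :
    ConvergesAt x (rescale a f) := by
  simpa only [ConvergesAt, rescale_term] using h

end Evaluation

/-! ### Distance from 1 to a nontrivial root of unity -/

section Roots

theorem norm_one_sub_pow_le {K : Type*} [NormedField K] [IsUltrametricDist K] {w : K}
    (hw : ‖w‖ ≤ 1) (n : ℕ) : ‖1 - w ^ n‖ ≤ ‖1 - w‖ := by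
  rw [← mul_neg_geom_sum w n, norm_mul]
  refine mul_le_of_le_one_right (norm_nonneg _) ?_
  refine IsUltrametricDist.norm_sum_le_of_forall_le_of_nonneg zero_le_one fun i _ => ?_
  rw [norm_pow]
  exact pow_le_one₀ (norm_nonneg _) hw

/-- For `w ≠ 1` the product of `1 - w^k` over `0 < k < q` is `q`, and each factor has norm at most
`‖1 - w‖`. -/
theorem eq_one_of_pow_prime_eq_one {K : Type*} [NormedField K] [IsUltrametricDist K] {q : ℕ}
    (hq : q.Prime) {w : K} (hw : w ^ q = 1) (h : ‖1 - w‖ ^ (q - 1) < ‖(q : K)‖) : w = 1 := by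
  by_contra hne
  have hprim : IsPrimitiveRoot w (q - 1 + 1) := by
    rw [Nat.sub_add_cancel hq.one_le]
    have : Fact q.Prime := ⟨hq⟩
    rw [← orderOf_eq_prime hw hne]
    exact IsPrimitiveRoot.orderOf w
  have hnorm : ‖w‖ ≤ 1 := by
    have := congrArg norm hw
    rw [norm_pow, norm_one] at this
    exact ((pow_eq_one_iff_of_nonneg (norm_nonneg w) hq.ne_zero).1 this).le
  have h1 := congrArg norm hprim.prod_one_sub_pow_eq_order
  rw [← Nat.cast_add_one, Nat.sub_add_cancel hq.one_le, norm_prod] at h1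
  refine absurd h (not_lt.2 ?_)
  rw [← h1]
  calc _ ≤ ∏ _k ∈ Finset.range (q - 1), ‖1 - w‖ :=
        Finset.prod_le_prod (fun _ _ => norm_nonneg _) fun k _ => norm_one_sub_pow_le hnorm _
    _ = _ := by rw [Finset.prod_const, Finset.card_range]

end Roots

/-! ### The Teichmüller character in an extension of `ℚ_p` -/

section Extension

variable {K : Type*} [NormedField K] [NormedAlgebra ℚ_[p] K]

/-- The Teichmüller character with values in an extension field of `ℚ_p`. -/
def teichK (K : Type*) [NormedField K] [NormedAlgebra ℚ_[p] K] : MulChar (ZMod p) K :=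
  (teichmullerChar p).ringHomComp ((algebraMap ℚ_[p] K).comp PadicInt.Coe.ringHom)

theorem teichK_apply (t : ZMod p) :
    teichK p K t = algebraMap ℚ_[p] K ((teichmullerChar p t : ℤ_[p]) : ℚ_[p]) := rfl

theorem norm_teichK_le (t : ZMod p) : ‖teichK p K t‖ ≤ 1 := by
  rw [teichK_apply, norm_algebraMap']
  exact PadicInt.norm_le_one _

theorem teichK_pow_prime (t : ZMod p) : teichK p K t ^ p = teichK p K t := by
  rw [← map_pow, ZMod.pow_card]

theorem norm_teichK_add_sub_lt (s t : ZMod p) :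
    ‖teichK p K s + teichK p K t - teichK p K (s + t)‖ < 1 := by
  have h : ‖teichmullerChar p s + teichmullerChar p t - teichmullerChar p (s + t)‖ < 1 := by
    rw [PadicInt.norm_lt_one_iff_dvd, ← Ideal.mem_span_singleton, ← PadicInt.maximalIdeal_eq_span_p,
      ← PadicInt.ker_toZMod, RingHom.mem_ker]
    simp [toZMod_teichmullerChar]
  rw [teichK_apply, teichK_apply, teichK_apply, ← map_add, ← map_sub, norm_algebraMap']
  exact h

/-- Reduction mod `p` recovers `x` from `ω(x)`, so the order of `ω` is the exponent of the group of
units of `𝔽_p`. -/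
theorem teichK_pow_eq_one_iff (k : ℕ) : teichK p K ^ k = 1 ↔ p - 1 ∣ k := by
  have hc := FiniteField.forall_pow_eq_one_iff (ZMod p) k
  rw [ZMod.card] at hc
  rw [← hc]
  constructor
  · intro h x
    have h1 : teichK p K ((x : ZMod p) ^ k) = 1 := by
      rw [map_pow, ← MulChar.pow_apply_coe, h, MulChar.one_apply_coe]
    rw [teichK_apply, ← map_one (algebraMap ℚ_[p] K)] at h1
    have h2 := (algebraMap ℚ_[p] K).injective h1
    have h3 : teichmullerChar p ((x : ZMod p) ^ k) = 1 := Subtype.ext h2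
    have h4 := toZMod_teichmullerChar p ((x : ZMod p) ^ k)
    rw [h3, map_one] at h4
    exact Units.ext (by simpa using h4.symm)
  · intro h
    ext x
    rw [MulChar.pow_apply_coe, MulChar.one_apply_coe, ← map_pow, ← Units.val_pow_eq_pow_val, h x]
    simp

theorem orderOf_teichK : orderOf (teichK p K) = p - 1 :=
  Nat.dvd_antisymm (orderOf_dvd_of_pow_eq_one ((teichK_pow_eq_one_iff p _).2 dvd_rfl))
    ((teichK_pow_eq_one_iff p _).1 (pow_orderOf_eq_one _))

/-! ### The element `π` with `π^(p-1) = -p`, Dwork's additive character and Gauss sums -/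

section Uniformizer

variable {π : K} (hπ : π ^ (p - 1) = -(p : K))

include hπ

omit [NormedAlgebra ℚ_[p] K] in
theorem pow_prime_eq_of_pow_pred : π ^ p = -(p : K) * π := by
  rw [← hπ, ← pow_succ, Nat.sub_add_cancel hp.out.one_le]

theorem norm_pow_pred : ‖π‖ ^ (p - 1) = (p : ℝ)⁻¹ := by
  rw [← norm_pow, hπ, norm_neg, ← map_natCast (algebraMap ℚ_[p] K), norm_algebraMap', Padic.norm_p]

theorem norm_pow_prime : ‖π‖ ^ p = (p : ℝ)⁻¹ * ‖π‖ := by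
  rw [← norm_pow_pred p hπ, ← pow_succ, Nat.sub_add_cancel hp.out.one_le]

theorem norm_lt_one_of_pow_pred : ‖π‖ < 1 := by
  by_contra h
  have h1 := one_le_pow₀ (n := p - 1) (not_lt.1 h)
  rw [norm_pow_pred p hπ] at h1
  exact absurd h1 (not_le.2 (inv_lt_one_of_one_lt₀ (by exact_mod_cast hp.out.one_lt)))

theorem norm_pos_of_pow_pred : 0 < ‖π‖ := by
  rw [norm_pos_iff]
  rintro rfl
  have h2 := norm_pow_pred p hπ
  rw [norm_zero, zero_pow (by have := hp.out.two_le; omega)] at h2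
  have : (p : ℝ) ≠ 0 := Nat.cast_ne_zero.2 hp.out.ne_zero
  exact inv_ne_zero this h2.symm

/-- Since `‖π‖^p = ‖π‖/p`, this is the inequality `R^p < p` again. It makes every term of degree at
least `p` smaller than the linear term at `π`. -/
theorem dworkRate_mul_norm_pow_lt : (dworkRate p * ‖π‖) ^ p < ‖π‖ := by
  have h0 := norm_pos_of_pow_pred p hπ
  rw [mul_pow, norm_pow_prime p hπ, ← mul_assoc]
  refine mul_lt_of_lt_one_left h0 ?_
  exact dworkRate_ratio_lt_one p

omit [NormedAlgebra ℚ_[p] K] hπ in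
theorem dworkRate_mul_norm_nonneg (π : K) : 0 ≤ dworkRate p * ‖π‖ :=
  mul_nonneg (zero_le_one.trans (one_le_dworkRate p)) (norm_nonneg _)

theorem dworkRate_mul_norm_lt_one : dworkRate p * ‖π‖ < 1 := by
  by_contra h
  have h1 := one_le_pow₀ (n := p) (not_lt.1 h)
  linarith [dworkRate_mul_norm_pow_lt p hπ, norm_lt_one_of_pow_pred p hπ]

omit hπ in
theorem norm_dworkCoeff_mul_le (h3 : 3 ≤ p) {x : K} (hx : ‖x‖ ≤ ‖π‖) (n : ℕ) :
    ‖algebraMap ℚ_[p] K (dworkCoeff p n) * x ^ n‖ ≤ (dworkRate p * ‖π‖) ^ n := by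
  rw [norm_mul, norm_algebraMap', norm_pow, mul_pow]
  have := one_le_dworkRate p
  gcongr
  exact norm_dworkCoeff_le p h3 n

theorem convergesAt_dworkExp (h3 : 3 ≤ p) {x : K} (hx : ‖x‖ ≤ ‖π‖) :
    ConvergesAt x (dworkExp p) :=
  Summable.of_nonneg_of_le (fun _ => norm_nonneg _) (norm_dworkCoeff_mul_le p h3 hx)
    (summable_geometric_of_lt_one (dworkRate_mul_norm_nonneg p π) (dworkRate_mul_norm_lt_one p hπ))

omit hπ in
-- The crude radius `1/p` suffices, because the exponential is evaluated only at `± p π t`.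
theorem convergesAt_exp {x : K} (hx : ‖x‖ < (p : ℝ)⁻¹) : ConvergesAt x (exp ℚ_[p]) := by
  have hp0 : (0 : ℝ) < p := by exact_mod_cast hp.out.pos
  have h2 : (2 : ℝ) ≤ p := by exact_mod_cast hp.out.two_le
  have hx1 : p * ‖x‖ < 1 := by
    calc _ < (p : ℝ) * (p : ℝ)⁻¹ := by gcongr
      _ = 1 := mul_inv_cancel₀ hp0.ne'
  refine Summable.of_nonneg_of_le (fun _ => norm_nonneg _) (fun n => ?_)
    (summable_geometric_of_lt_one (r := p * ‖x‖) (by positivity) hx1)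
  have hc : (p : ℝ) ^ (1 / ((p : ℝ) - 1)) ≤ p := by
    conv_rhs => rw [← Real.rpow_one (p : ℝ)]
    refine Real.rpow_le_rpow_of_exponent_le (by linarith) ?_
    rw [div_le_one (by linarith)]; linarith
  have h4 : ‖(algebraMap ℚ ℚ_[p]) (1 / (n.factorial : ℚ))‖ =
      ‖((n.factorial : ℕ) : ℚ_[p])‖⁻¹ := by simp
  rw [norm_mul, norm_algebraMap', norm_pow, mul_pow, coeff_exp, h4]
  gcongr
  exact (norm_factorial_inv_le p n).trans (by gcongr)

variable [CompleteSpace K]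

/-- From `t^p = t` and `π^(p-1) = -p`, the point `x = πt` satisfies `x^p = -p x`. So `E(x)^p = exp(p
x) exp(-p x) = 1`. -/
theorem seriesValue_dworkExp_pow (h3 : 3 ≤ p) {t : K} (ht : t ^ p = t) (ht1 : ‖t‖ ≤ 1) :
    seriesValue (π * t) (dworkExp p) ^ p = 1 := by
  have hp0 : (0 : ℝ) < p := by exact_mod_cast hp.out.pos
  have hx : ‖π * t‖ ≤ ‖π‖ := by
    rw [norm_mul]; exact mul_le_of_le_one_right (norm_nonneg _) ht1
  have hpx : ‖(p : K) * (π * t)‖ < (p : ℝ)⁻¹ := by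
    rw [norm_mul, ← map_natCast (algebraMap ℚ_[p] K), norm_algebraMap', Padic.norm_p]
    exact mul_lt_of_lt_one_right (by positivity) (hx.trans_lt (norm_lt_one_of_pow_pred p hπ))
  have hxp : (π * t) ^ p = algebraMap ℚ_[p] K (-(p : ℚ_[p])) * (π * t) := by
    rw [mul_pow, ht, pow_prime_eq_of_pow_pred p hπ, map_neg, map_natCast]; ring
  have h1 : ConvergesAt (π * t) (rescale (p : ℚ_[p]) (exp ℚ_[p])) :=
    convergesAt_rescale (convergesAt_exp p (by rwa [map_natCast]))
  have h2' : ConvergesAt (algebraMap ℚ_[p] K (-(p : ℚ_[p])) * (π * t)) (exp ℚ_[p]) :=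
    convergesAt_exp p (by rwa [map_neg, map_natCast, neg_mul, norm_neg])
  have h2 : ConvergesAt (π * t) (expand p hp.out.ne_zero (exp ℚ_[p])) :=
    convergesAt_expand _ (by rwa [hxp])
  rw [← seriesValue_pow (convergesAt_dworkExp p hπ h3 hx), dworkExp_pow, seriesValue_mul h1 h2,
    seriesValue_expand, hxp, ← seriesValue_rescale, ← seriesValue_mul h1 (convergesAt_rescale h2'),
    exp_mul_exp_eq_exp_add, add_neg_cancel, rescale_zero]
  simp [seriesValue_one]

variable [IsUltrametricDist K]

theorem exists_norm_seriesValue_sub_le (h3 : 3 ≤ p) :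
    ∃ ρ < ‖π‖, ∀ x : K, ‖x‖ ≤ ‖π‖ → ‖seriesValue x (dworkExp p) - (1 + x)‖ ≤ ρ := by
  have h0 := norm_pos_of_pow_pred p hπ
  have h1 := norm_lt_one_of_pow_pred p hπ
  -- Degrees from `2` to `p - 1` have integral coefficients and are bounded by `‖π‖ ^ 2`; higher
  -- degrees use the growth rate. A single `ρ` is needed because strict termwise bounds would give
  -- only `≤ ‖π‖` for the infinite sum.
  refine ⟨max (‖π‖ ^ 2) ((dworkRate p * ‖π‖) ^ p), max_lt ?_ (dworkRate_mul_norm_pow_lt p hπ),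
    fun x hx => ?_⟩
  · rw [sq]; exact mul_lt_of_lt_one_left h0 h1
  · have hs : Summable fun n => algebraMap ℚ_[p] K (coeff n (dworkExp p)) * x ^ n :=
      (convergesAt_dworkExp p hπ h3 hx).of_norm
    have h2 : seriesValue x (dworkExp p) - (1 + x) =
        ∑' n, algebraMap ℚ_[p] K (coeff (n + 2) (dworkExp p)) * x ^ (n + 2) := by
      have h4 := hs.sum_add_tsum_nat_add 2
      have h5 : coeff 0 (dworkExp p) = 1 := dworkCoeff_zero p
      have h6 : coeff 1 (dworkExp p) = 1 := dworkCoeff_one p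
      rw [Finset.sum_range_succ, Finset.sum_range_one, h5, h6] at h4
      rw [seriesValue, ← h4]
      simp
    rw [h2]
    refine IsUltrametricDist.norm_tsum_le_of_forall_le_of_nonneg (by positivity) fun n => ?_
    by_cases hn : n + 2 < p
    · refine le_max_of_le_left ?_
      rw [norm_mul, norm_algebraMap', norm_pow]
      have h4 : ‖coeff (n + 2) (dworkExp p)‖ ≤ 1 := norm_dworkCoeff_le_one p hn
      calc _ ≤ 1 * ‖π‖ ^ (n + 2) := by gcongr
        _ ≤ ‖π‖ ^ 2 := by
          rw [one_mul]; exact pow_le_pow_of_le_one h0.le h1.le (by omega)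
    · refine le_max_of_le_right ((norm_dworkCoeff_mul_le p h3 hx (n + 2)).trans ?_)
      exact pow_le_pow_of_le_one (dworkRate_mul_norm_nonneg p π)
        (dworkRate_mul_norm_lt_one p hπ).le (by omega)

/-- The values `θ(u)` at `π ω(u)` are `p`-th roots of unity with `θ(u) ≡ 1 + π ω(u)` up to terms
smaller than `π`, and `ω` is additive mod `p`. Thus `θ(s) θ(t) / θ(s+t)` is a `p`-th root of unity
at distance less than `‖π‖` from `1`. As `‖π‖^(p-1) = ‖p‖`, it equals `1`. -/
theorem seriesValue_dworkExp_add (h3 : 3 ≤ p) (s t : ZMod p) :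
    seriesValue (π * teichK p K (s + t)) (dworkExp p) =
      seriesValue (π * teichK p K s) (dworkExp p) * seriesValue (π * teichK p K t) (dworkExp p) := by
  obtain ⟨ρ, hρ, hρx⟩ := exists_norm_seriesValue_sub_le p hπ h3
  have h0 := norm_pos_of_pow_pred p hπ
  have h1 := norm_lt_one_of_pow_pred p hπ
  set θ : ZMod p → K := fun u => seriesValue (π * teichK p K u) (dworkExp p) with hθ
  have hpow : ∀ u, θ u ^ p = 1 := fun u =>
    seriesValue_dworkExp_pow p hπ h3 (teichK_pow_prime p u) (norm_teichK_le p u)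
  have hnorm : ∀ u, ‖θ u‖ = 1 := fun u => by
    have := congrArg norm (hpow u)
    rw [norm_pow, norm_one] at this
    exact (pow_eq_one_iff_of_nonneg (norm_nonneg _) hp.out.ne_zero).1 this
  have happ : ∀ u, ‖θ u - (1 + π * teichK p K u)‖ < ‖π‖ := fun u =>
    (hρx _ (by rw [norm_mul]; exact mul_le_of_le_one_right h0.le (norm_teichK_le p u))).trans_lt hρ
  have hadd : ∀ {a b : K}, ‖a‖ < ‖π‖ → ‖b‖ < ‖π‖ → ‖a + b‖ < ‖π‖ := fun ha hb =>
    (IsUltrametricDist.norm_add_le_max _ _).trans_lt (max_lt ha hb)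
  have hneu : ∀ u, ‖1 + π * teichK p K u‖ ≤ 1 := fun u => by
    refine (IsUltrametricDist.norm_add_le_max _ _).trans (max_le norm_one.le ?_)
    rw [norm_mul]
    exact mul_le_one₀ h1.le (norm_nonneg _) (norm_teichK_le p u)
  have hdiff : ‖θ (s + t) - θ s * θ t‖ < ‖π‖ := by
    have hd : θ (s + t) - θ s * θ t = (θ (s + t) - (1 + π * teichK p K (s + t))) +
        (-((θ s - (1 + π * teichK p K s)) * θ t) +
          (-((1 + π * teichK p K s) * (θ t - (1 + π * teichK p K t))) +
            (-(π * (teichK p K s + teichK p K t - teichK p K (s + t))) +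
              -(π * (π * (teichK p K s * teichK p K t)))))) := by ring
    rw [hd]
    refine hadd (happ _) (hadd ?_ (hadd ?_ (hadd ?_ ?_)))
    · rw [norm_neg, norm_mul, hnorm, mul_one]; exact happ s
    · rw [norm_neg, norm_mul]
      exact (mul_le_of_le_one_left (norm_nonneg _) (hneu s)).trans_lt (happ t)
    · rw [norm_neg, norm_mul]
      exact mul_lt_of_lt_one_right h0 (norm_teichK_add_sub_lt p s t)
    · rw [norm_neg, norm_mul, norm_mul, norm_mul]
      refine mul_lt_of_lt_one_right h0 (lt_of_le_of_lt ?_ h1)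
      exact mul_le_of_le_one_right h0.le
        (mul_le_one₀ (norm_teichK_le p s) (norm_nonneg _) (norm_teichK_le p t))
  have hne : θ (s + t) ≠ 0 := norm_pos_iff.1 (by rw [hnorm]; exact one_pos)
  have hone : θ s * θ t / θ (s + t) = 1 := by
    refine eq_one_of_pow_prime_eq_one hp.out ?_ ?_
    · rw [div_pow, mul_pow, hpow, hpow, hpow]; simp
    · rw [one_sub_div hne, norm_div, hnorm, div_one, ← map_natCast (algebraMap ℚ_[p] K),
        norm_algebraMap', Padic.norm_p, ← norm_pow_pred p hπ]
      exact pow_lt_pow_left₀ hdiff (norm_nonneg _) (by have := hp.out.two_le; omega)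
  rw [div_eq_one_iff_eq hne] at hone
  exact hone.symm

/-- Dwork's additive character of `𝔽_p`. -/
def dworkChar (h3 : 3 ≤ p) : AddChar (ZMod p) K where
  toFun t := seriesValue (π * teichK p K t) (dworkExp p)
  map_zero_eq_one' := by
    rw [MulChar.map_zero, mul_zero, seriesValue, tsum_eq_single 0]
    · have : coeff 0 (dworkExp p) = 1 := dworkCoeff_zero p
      rw [this]; simp
    · intro n hn
      rw [zero_pow hn, mul_zero]
  map_add_eq_mul' := seriesValue_dworkExp_add p hπ h3

theorem dworkChar_apply (h3 : 3 ≤ p) (t : ZMod p) :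
    dworkChar p hπ h3 t = seriesValue (π * teichK p K t) (dworkExp p) := rfl

/-- The value at `1` is `1 + π` up to an error smaller than `π`, so it is not `1`. -/
theorem dworkChar_isPrimitive (h3 : 3 ≤ p) : (dworkChar p hπ h3).IsPrimitive := by
  refine AddChar.IsPrimitive.of_ne_one fun h => ?_
  obtain ⟨ρ, hρ, hρx⟩ := exists_norm_seriesValue_sub_le p hπ h3
  have h1 := hρx π le_rfl
  have h2 := DFunLike.congr_fun h 1
  rw [dworkChar_apply, map_one, mul_one, AddChar.one_apply] at h2
  rw [h2, sub_add_cancel_left, norm_neg] at h1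
  linarith

omit hπ [CompleteSpace K] [IsUltrametricDist K] in
theorem sum_teichK_inv_pow_mul (a n : ℕ) :
    ∑ t : ZMod p, ((teichK p K)⁻¹ ^ a) t * teichK p K t ^ n =
      if a ≡ n [MOD p - 1] then (p : K) - 1 else 0 := by
  classical
  have h1 : ∑ t : ZMod p, ((teichK p K)⁻¹ ^ a) t * teichK p K t ^ n =
      ∑ t : ZMod p, ((teichK p K)⁻¹ ^ a * teichK p K ^ n) t := by
    refine Finset.sum_congr rfl fun t _ => ?_
    by_cases ht : IsUnit t
    · obtain ⟨u, rfl⟩ := ht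
      rw [MulChar.mul_apply, MulChar.pow_apply_coe (teichK p K)]
    · rw [MulChar.map_nonunit _ ht, MulChar.map_nonunit (_ * _) ht, zero_mul]
  have h2 : (teichK p K)⁻¹ ^ a * teichK p K ^ n = 1 ↔ a ≡ n [MOD p - 1] := by
    rw [inv_pow, inv_mul_eq_one, pow_eq_pow_iff_modEq, orderOf_teichK]
  rw [h1]
  split_ifs with h
  · rw [h2.2 h, MulChar.sum_one_eq_card_units, ZMod.card_units, Nat.cast_sub hp.out.one_le,
      Nat.cast_one]
  · exact MulChar.sum_eq_zero_of_ne_one fun h' => h (h2.1 h')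

/-- The Gross–Koblitz formula over `𝔽_p`, in terms of Dwork's sum. -/
theorem gaussSum_teichK (h3 : 3 ≤ p) {a : ℕ} (ha : a < p - 1) {z : ℤ_[p]}
    (hz : (a : ℤ_[p]) = (p - 1) * z) :
    gaussSum ((teichK p K)⁻¹ ^ a) (dworkChar p hπ h3) =
      -(π ^ a * algebraMap ℚ_[p] K (dworkSum p a z)) := by
  have hinj : Function.Injective fun k : ℕ => a + (p - 1) * k := fun k l hkl =>
    Nat.eq_of_mul_eq_mul_left (by have := hp.out.two_le; omega : 0 < p - 1) (Nat.add_left_cancel hkl)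
  have hs : ∀ t : ZMod p, Summable fun n => algebraMap ℚ_[p] K (coeff n (dworkExp p)) *
      (π * teichK p K t) ^ n := fun t =>
    (convergesAt_dworkExp p hπ h3 (by
      rw [norm_mul]; exact mul_le_of_le_one_right (norm_nonneg _) (norm_teichK_le p t))).of_norm
  have h1 : gaussSum ((teichK p K)⁻¹ ^ a) (dworkChar p hπ h3) =
      ∑' n, algebraMap ℚ_[p] K (dworkCoeff p n) * π ^ n *
        (if a ≡ n [MOD p - 1] then (p : K) - 1 else 0) := by
    simp only [gaussSum, dworkChar_apply, seriesValue, ← tsum_mul_left]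
    rw [← Summable.tsum_finsetSum fun t _ => (hs t).mul_left _]
    refine tsum_congr fun n => ?_
    rw [← sum_teichK_inv_pow_mul, Finset.mul_sum]
    refine Finset.sum_congr rfl fun t _ => ?_
    rw [mul_pow, dworkCoeff]
    ring
  have h2 := ((hasSum_dworkCoeff_arith p h3 hz).map (algebraMap ℚ_[p] K)
    (continuous_algebraMap ℚ_[p] K)).mul_left (-π ^ a)
  -- Orthogonality leaves the indices `n = a + (p-1) k`, where `a < p - 1` ensures that `a` is the
  -- least of them. Then `π^n = π^a (-p)^k`, which is the series of the trace formula.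
  rw [h1, ← hinj.tsum_eq]
  · rw [← neg_mul, ← h2.tsum_eq]
    refine tsum_congr fun k => ?_
    rw [if_pos (by simp [Nat.ModEq]), pow_add, pow_mul, hπ]
    simp only [Function.comp_apply, map_mul, map_sub, map_one, map_natCast, map_pow, map_neg]
    ring
  · intro n hn
    by_contra h
    refine hn ?_
    simp only
    rw [if_neg, mul_zero]
    intro hmod
    apply h
    have hle : a ≤ n := by
      have := Nat.mod_le n (p - 1)
      rw [← hmod, Nat.mod_eq_of_lt ha] at this
      exact this
    obtain ⟨k, hk⟩ := (Nat.modEq_iff_dvd' hle).1 hmod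
    exact ⟨k, by simp only; omega⟩

end Uniformizer

end Extension

/-! ### Gross–Koblitz descended to `ℚ_p`: gamma values and Jacobi sums -/

theorem exists_pow_pred_eq_neg (h3 : 3 ≤ p) : ∃ π : ℂ_[p], π ^ (p - 1) = -(p : ℂ_[p]) :=
  IsAlgClosed.exists_pow_nat_eq _ (by omega)

theorem norm_natCast_sub_one : ‖(p : ℚ_[p]) - 1‖ = 1 := by
  have h := norm_natCast_of_lt p (n := p - 1) (by have := hp.out.two_le; omega)
    (by have := hp.out.two_le; omega)
  rwa [Nat.cast_sub hp.out.one_le, Nat.cast_one] at h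

/-- The `p`-adic integer `a / (p - 1)`. -/
def divPred (a : ℕ) : ℤ_[p] :=
  ⟨a / ((p : ℚ_[p]) - 1), by
    rw [norm_div, norm_natCast_sub_one, div_one]
    exact (PadicInt.norm_le_one (a : ℤ_[p]))⟩

theorem coe_divPred (a : ℕ) : (divPred p a : ℚ_[p]) = a / ((p : ℚ_[p]) - 1) := rfl

theorem pred_ne_zero : (p : ℚ_[p]) - 1 ≠ 0 := by
  rw [← norm_pos_iff, norm_natCast_sub_one]; exact one_pos

theorem pred_mul_divPred (a : ℕ) : (a : ℤ_[p]) = (p - 1) * divPred p a := by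
  apply Subtype.ext
  have h := pred_ne_zero p
  push_cast
  rw [coe_divPred]
  field_simp

/-- Dwork's sum at `a / (p - 1)`. -/
def dworkValue (a : ℕ) : ℚ_[p] := dworkSum p a (divPred p a)

/-- The Jacobi sum `J(ω⁻ᵃ, ω⁻ᵇ)` over `𝔽_p` with values in `ℚ_p`. -/
def teichJacobi (a b : ℕ) : ℚ_[p] :=
  jacobiSum ((teichK p ℚ_[p])⁻¹ ^ a) ((teichK p ℚ_[p])⁻¹ ^ b)

theorem teichK_inv_pow_apply {K : Type*} [NormedField K] [NormedAlgebra ℚ_[p] K] (a : ℕ)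
    (t : ZMod p) : ((teichK p K)⁻¹ ^ a) t =
      algebraMap ℚ_[p] K ((((teichmullerChar p)⁻¹ ^ a) t : ℤ_[p]) : ℚ_[p]) := by
  by_cases ht : IsUnit t
  · obtain ⟨u, rfl⟩ := ht
    rw [MulChar.pow_apply_coe, MulChar.pow_apply_coe, MulChar.inv_apply, MulChar.inv_apply,
      PadicInt.coe_pow, map_pow, teichK_apply]
  · rw [MulChar.map_nonunit _ ht, MulChar.map_nonunit _ ht]
    simp

theorem map_teichJacobi {K : Type*} [NormedField K] [NormedAlgebra ℚ_[p] K] (a b : ℕ) :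
    algebraMap ℚ_[p] K (teichJacobi p a b) =
      jacobiSum ((teichK p K)⁻¹ ^ a) ((teichK p K)⁻¹ ^ b) := by
  simp only [teichJacobi, jacobiSum, map_sum, map_mul, teichK_inv_pow_apply, Algebra.algebraMap_self,
    RingHom.id_apply]

theorem teichK_neg_one {K : Type*} [NormedField K] [NormedAlgebra ℚ_[p] K] (h2 : p ≠ 2) :
    teichK p K (-1) = -1 := by
  have h1 : teichK p K (-1) * teichK p K (-1) = 1 := by rw [← map_mul]; simp
  rcases mul_self_eq_one_iff.1 h1 with h | h
  · exfalso
    have h4 := toZMod_teichmullerChar p (-1)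
    rw [teichK_apply, ← map_one (algebraMap ℚ_[p] K)] at h
    have h5 := (algebraMap ℚ_[p] K).injective h
    have h6 : teichmullerChar p (-1) = 1 := Subtype.ext h5
    rw [h6, map_one] at h4
    have : Fact (2 < p) := ⟨by have := hp.out.two_le; omega⟩
    exact ZMod.neg_one_ne_one h4.symm
  · exact h

theorem teichK_inv_pow_eq_one_iff {K : Type*} [NormedField K] [NormedAlgebra ℚ_[p] K] (a : ℕ) :
    (teichK p K)⁻¹ ^ a = 1 ↔ p - 1 ∣ a := by
  rw [inv_pow, inv_eq_one, teichK_pow_eq_one_iff]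

/-- The reflection formula, obtained from `g(χ) g(χ⁻¹) = χ(-1) p` for `χ = ω^(-a)`, using `π^a π^b =
-p`. -/
theorem dworkValue_mul_dworkValue (h2 : p ≠ 2) {a b : ℕ} (ha : 0 < a) (hb : 0 < b)
    (hab : a + b = p - 1) : dworkValue p a * dworkValue p b = -(-1) ^ a := by
  have h3 : 3 ≤ p := by have := hp.out.two_le; omega
  obtain ⟨π, hπ⟩ := exists_pow_pred_eq_neg p h3
  have hne : (teichK p ℂ_[p])⁻¹ ^ a ≠ 1 := fun h => by
    have := Nat.le_of_dvd ha ((teichK_inv_pow_eq_one_iff p a).1 h)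
    omega
  have hinv : ((teichK p ℂ_[p])⁻¹ ^ a)⁻¹ = (teichK p ℂ_[p])⁻¹ ^ b := by
    rw [_root_.inv_eq_iff_mul_eq_one, ← pow_add, hab, teichK_inv_pow_eq_one_iff]
  have h := gaussSum_mul_gaussSum_eq_card hne (dworkChar_isPrimitive p hπ h3)
  have hsign : ((teichK p ℂ_[p])⁻¹ ^ b) (-1) = (-1) ^ b := by
    have : (-1 : ZMod p) = ((-1 : (ZMod p)ˣ) : ZMod p) := by simp
    rw [this, MulChar.pow_apply_coe, MulChar.inv_apply_eq_inv', Units.val_neg, Units.val_one,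
      teichK_neg_one p h2, inv_neg_one]
  -- The product formula involves the inverse additive character in one factor; replacing it by the
  -- original character costs the sign `(-1)^b`.
  have h5 := mul_gaussSum_inv_eq_gaussSum ((teichK p ℂ_[p])⁻¹ ^ b) (dworkChar p hπ h3)
  rw [hsign, gaussSum_teichK p hπ h3 (by omega) (pred_mul_divPred p b)] at h5
  rw [hinv, gaussSum_teichK p hπ h3 (by omega) (pred_mul_divPred p a), ZMod.card] at h
  have hbb : (-1 : ℂ_[p]) ^ b * (-1) ^ b = 1 := by rw [← mul_pow]; simp
  have habs : (-1 : ℂ_[p]) ^ a * (-1) ^ b = 1 := by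
    rw [← pow_add, hab]
    exact (hp.out.even_sub_one h2).neg_one_pow
  have hpp : π ^ a * π ^ b = -(p : ℂ_[p]) := by rw [← pow_add, hab, hπ]
  have hp0 : (p : ℂ_[p]) ≠ 0 := Nat.cast_ne_zero.2 hp.out.ne_zero
  apply (algebraMap ℚ_[p] ℂ_[p]).injective
  rw [map_mul, map_neg, map_pow, map_neg, map_one]
  simp only [dworkValue]
  generalize gaussSum ((teichK p ℂ_[p])⁻¹ ^ b) (dworkChar p hπ h3)⁻¹ = g at h h5
  generalize algebraMap ℚ_[p] ℂ_[p] (dworkSum p a (divPred p a)) = A at *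
  generalize algebraMap ℚ_[p] ℂ_[p] (dworkSum p b (divPred p b)) = B at *
  have hg : g = -((-1) ^ b * π ^ b * B) := by linear_combination (-1) ^ b * h5 - g * hbb
  have hAB : (-1) ^ b * (A * B) = -1 := by
    apply mul_left_cancel₀ hp0
    rw [hg] at h
    linear_combination -h + (-1) ^ b * A * B * hpp
  linear_combination (-1) ^ a * hAB - A * B * habs

theorem dworkValue_ne_zero (h2 : p ≠ 2) {a : ℕ} (ha : a < p) : dworkValue p a ≠ 0 := fun h => by
  have := one_le_norm_dworkSum p h2 ha (divPred p a)
  rw [dworkValue] at h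
  rw [h, norm_zero] at this
  linarith

theorem gammaRat_zero : gammaRat p 0 = 1 := by
  have h : ‖((0 : ℚ) : ℚ_[p])‖ ≤ 1 := by simp
  rw [gammaRat, dif_pos h]
  have : (0 : ℤ_[p]) = ⟨((0 : ℚ) : ℚ_[p]), h⟩ := Subtype.ext (by simp)
  rw [← this, gamma, if_pos rfl]
  rfl

/-- With `b = p - 1 - a` one has `a/(p-1) = 1 + b - p · b/(p-1)`. So Dwork's formula gives the
inverse of the value at `b`, up to sign, and the reflection formula turns it into the value at `a`.
-/
theorem gammaRat_div_pred (h2 : p ≠ 2) {a : ℕ} (ha : 0 < a) (hap : a < p - 1) :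
    gammaRat p ((a : ℚ) / ((p : ℚ) - 1)) = dworkValue p a := by
  obtain ⟨b, hb⟩ : ∃ b, a + b = p - 1 := ⟨p - 1 - a, by omega⟩
  have hcast : (((a : ℚ) / ((p : ℚ) - 1) : ℚ) : ℚ_[p]) = divPred p a := by
    rw [coe_divPred]; push_cast; rfl
  have hnorm : ‖(((a : ℚ) / ((p : ℚ) - 1) : ℚ) : ℚ_[p])‖ ≤ 1 := by
    rw [hcast]; exact PadicInt.norm_le_one _
  have hsub : (⟨(((a : ℚ) / ((p : ℚ) - 1) : ℚ) : ℚ_[p]), hnorm⟩ : ℤ_[p]) = divPred p a :=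
    Subtype.ext hcast
  have hx0 : divPred p a ≠ 0 := by
    intro h
    have := pred_mul_divPred p a
    rw [h, mul_zero] at this
    exact ha.ne' (by exact_mod_cast this)
  have hx : divPred p a = 1 + b - p * divPred p b := by
    have h0 := pred_ne_zero p
    have hab := congrArg (Nat.cast (R := ℚ_[p])) hb
    rw [Nat.cast_add, Nat.cast_sub hp.out.one_le, Nat.cast_one] at hab
    apply Subtype.ext
    push_cast
    rw [coe_divPred, coe_divPred]
    field_simp
    linear_combination hab
  have hbne := dworkValue_ne_zero p h2 (a := b) (by omega)
  have hrefl := dworkValue_mul_dworkValue p h2 (a := b) (by omega) ha (by omega)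
  have hbb : (-1 : ℚ_[p]) ^ b * (-1) ^ b = 1 := by rw [← mul_pow]; simp
  rw [gammaRat, dif_pos hnorm, hsub, gamma_eq_inv_dworkSum p h2 (by omega) _ hx hx0]
  refine inv_eq_of_mul_eq_one_right ?_
  change (-1) ^ (b + 1) * dworkValue p b * dworkValue p a = 1
  rw [pow_succ]
  linear_combination -(-1) ^ b * hrefl + hbb

/-- This is `g(χψ) J(χ, ψ) = g(χ) g(ψ)`, valid because `0 < c < p - 1` makes `χψ` nontrivial. In the
two lemmas that follow, the powers of `π` cancel exactly if `a + b` does not pass `p - 1`, and leave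
`π^(p-1) = -p` if it does. -/
theorem gaussSum_relation (h3 : 3 ≤ p) {π : ℂ_[p]} (hπ : π ^ (p - 1) = -(p : ℂ_[p])) {a b c : ℕ}
    (ha : a < p - 1) (hb : b < p - 1) (hc : c < p - 1) (hc0 : 0 < c) (habc : c ≡ a + b [MOD p - 1]) :
    -(π ^ c * algebraMap ℚ_[p] ℂ_[p] (dworkValue p c)) *
      algebraMap ℚ_[p] ℂ_[p] (teichJacobi p a b) =
      π ^ a * algebraMap ℚ_[p] ℂ_[p] (dworkValue p a) *
        (π ^ b * algebraMap ℚ_[p] ℂ_[p] (dworkValue p b)) := by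
  have hchar : (teichK p ℂ_[p])⁻¹ ^ a * (teichK p ℂ_[p])⁻¹ ^ b = (teichK p ℂ_[p])⁻¹ ^ c := by
    rw [← pow_add, pow_eq_pow_iff_modEq, orderOf_inv, orderOf_teichK]
    exact habc.symm
  have hne : (teichK p ℂ_[p])⁻¹ ^ a * (teichK p ℂ_[p])⁻¹ ^ b ≠ 1 := by
    rw [hchar]
    intro h
    have := Nat.le_of_dvd hc0 ((teichK_inv_pow_eq_one_iff p c).1 h)
    omega
  have h := jacobiSum_mul_nontrivial hne (dworkChar p hπ h3)
  rw [hchar, gaussSum_teichK p hπ h3 hc (pred_mul_divPred p c),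
    gaussSum_teichK p hπ h3 ha (pred_mul_divPred p a),
    gaussSum_teichK p hπ h3 hb (pred_mul_divPred p b), ← map_teichJacobi, neg_mul_neg] at h
  exact h

theorem dworkValue_mul_teichJacobi_of_lt (h3 : 3 ≤ p) {a b : ℕ} (h0 : 0 < a + b)
    (hab : a + b < p - 1) :
    -dworkValue p (a + b) * teichJacobi p a b = dworkValue p a * dworkValue p b := by
  obtain ⟨π, hπ⟩ := exists_pow_pred_eq_neg p h3
  have h := gaussSum_relation p h3 hπ (by omega) (by omega) hab h0 (Nat.ModEq.refl _)
  have hπ0 : π ^ (a + b) ≠ 0 := pow_ne_zero _ (norm_pos_iff.1 (norm_pos_of_pow_pred p hπ))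
  apply (algebraMap ℚ_[p] ℂ_[p]).injective
  rw [map_mul, map_neg, map_mul]
  apply mul_left_cancel₀ hπ0
  rw [mul_comm] at h ⊢
  linear_combination h

theorem dworkValue_mul_teichJacobi_of_add (h3 : 3 ≤ p) {a b c : ℕ} (ha : a < p - 1)
    (hb : b < p - 1) (hc0 : 0 < c) (habc : a + b = c + (p - 1)) :
    dworkValue p c * teichJacobi p a b = p * (dworkValue p a * dworkValue p b) := by
  obtain ⟨π, hπ⟩ := exists_pow_pred_eq_neg p h3
  have h := gaussSum_relation p h3 hπ ha hb (c := c) (by omega) hc0 (by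
    rw [habc]; simp [Nat.ModEq])
  have hπ0 : π ^ c ≠ 0 := pow_ne_zero _ (norm_pos_iff.1 (norm_pos_of_pow_pred p hπ))
  have hpp : π ^ a * π ^ b = π ^ c * -(p : ℂ_[p]) := by rw [← pow_add, habc, pow_add, hπ]
  apply (algebraMap ℚ_[p] ℂ_[p]).injective
  rw [map_mul, map_mul, map_mul, map_natCast]
  apply mul_left_cancel₀ hπ0
  linear_combination -h - algebraMap ℚ_[p] ℂ_[p] (dworkValue p a) *
    algebraMap ℚ_[p] ℂ_[p] (dworkValue p b) * hpp

/-! ### The Jacobi sum with the quadratic character -/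

/-- The factor that the parameters `1 / 2` and `1` contribute to the `j`-th term of `G`. -/
def halfFactor (j : ℕ) : ℚ_[p] :=
  (gammaRat p (Int.fract (1 / 2 - (j : ℚ) / ((p : ℚ) - 1))) / gammaRat p (Int.fract (1 / 2))) *
    (gammaRat p (Int.fract (-1 + (j : ℚ) / ((p : ℚ) - 1))) / gammaRat p (Int.fract (-1))) *
    (-(p : ℚ_[p])) ^ (-⌊Int.fract (1 / 2 : ℚ) - (j : ℚ) / ((p : ℚ) - 1)⌋
      - ⌊Int.fract (-1 : ℚ) + (j : ℚ) / ((p : ℚ) - 1)⌋)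

/-- For `h = (p-1)/2` the cases `j < h`, `j = h` and `j > h` correspond to no carry, a trivial
product character and a carry in `j + h`. The reflection formula moves the gamma value from the
denominator of the Jacobi sum to the numerator. -/
theorem teichJacobi_half_eq (h2 : p ≠ 2) {j : ℕ} (hj : j < p - 1) :
    teichJacobi p j ((p - 1) / 2) = -((-1) ^ j * halfFactor p j) := by
  have hp2 := hp.out.two_le
  obtain ⟨h, hh⟩ : ∃ h, p = 2 * h + 1 := hp.out.odd_of_ne_two h2
  have hhalf : (p - 1) / 2 = h := by omega
  have hh0 : 0 < h := by omega
  have hq : (p : ℚ) - 1 = 2 * h := by rw [hh]; push_cast; ring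
  have hhq : (0 : ℚ) < h := by exact_mod_cast hh0
  have hsq : ∀ k : ℕ, (-1 : ℚ_[p]) ^ k * (-1) ^ k = 1 := fun k => by rw [← mul_pow]; simp
  have hW : ∀ a : ℕ, 0 < a → a < 2 * h → gammaRat p ((a : ℚ) / (2 * h)) = dworkValue p a := by
    intro a h0 h1
    rw [← hq]
    exact gammaRat_div_pred p h2 h0 (by omega)
  have hWne : ∀ a : ℕ, a < 2 * h → dworkValue p a ≠ 0 := fun a ha =>
    dworkValue_ne_zero p h2 (by omega)
  have hΓhalf : gammaRat p (1 / 2) = dworkValue p h := by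
    rw [← hW h hh0 (by omega)]
    congr 1
    field_simp
  have hf1 : Int.fract (1 / 2 : ℚ) = 1 / 2 := Int.fract_eq_self.2 ⟨by norm_num, by norm_num⟩
  have hf2 : Int.fract (-1 : ℚ) = 0 := by
    simp
  have hj0 : (0 : ℚ) ≤ (j : ℚ) / (2 * h) := by positivity
  have hj1 : (j : ℚ) / (2 * h) < 1 := by
    rw [div_lt_one (by positivity)]
    exact_mod_cast (by omega : j < 2 * h)
  have hf3 : Int.fract (-1 + (j : ℚ) / (2 * h)) = (j : ℚ) / (2 * h) := by
    rw [Int.fract_eq_iff]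
    exact ⟨hj0, hj1, -1, by push_cast; ring⟩
  have hfl : ⌊(j : ℚ) / (2 * h)⌋ = 0 := Int.floor_eq_zero_iff.2 ⟨hj0, hj1⟩
  rw [halfFactor, hq, hf1, hf2, hf3, gammaRat_zero, zero_add, hfl, hΓhalf, hhalf, sub_zero, div_one]
  have hhne := hWne h (by omega)
  have hφ : (teichK p ℚ_[p])⁻¹ ^ h ≠ 1 := fun hc => by
    have := Nat.le_of_dvd hh0 ((teichK_inv_pow_eq_one_iff p h).1 hc)
    omega
  have hrefl : ∀ a b : ℕ, 0 < a → 0 < b → a + b = 2 * h →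
      dworkValue p a * dworkValue p b = -(-1) ^ a := fun a b ha hb hab =>
    dworkValue_mul_dworkValue p h2 ha hb (by omega)
  rcases lt_trichotomy j h with hjh | hjh | hjh
  · obtain ⟨k, rfl⟩ := Nat.exists_eq_add_of_lt hjh
    set h := j + k + 1 with hdef
    have hdiff : (1 / 2 : ℚ) - (j : ℚ) / (2 * h) = ((k + 1 : ℕ) : ℚ) / (2 * h) := by
      field_simp
      rw [hdef]; push_cast; ring
    have hlt : ((k + 1 : ℕ) : ℚ) / (2 * h) < 1 := by
      rw [div_lt_one (by positivity)]
      exact_mod_cast (by omega : k + 1 < 2 * h)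
    have hfr : Int.fract (((k + 1 : ℕ) : ℚ) / (2 * h)) = ((k + 1 : ℕ) : ℚ) / (2 * h) :=
      Int.fract_eq_self.2 ⟨by positivity, hlt⟩
    have hfl2 : ⌊((k + 1 : ℕ) : ℚ) / (2 * h)⌋ = 0 :=
      Int.floor_eq_zero_iff.2 ⟨by positivity, hlt⟩
    rw [hdiff, hfr, hfl2, neg_zero, zpow_zero, mul_one, hW _ (by omega) (by omega)]
    rcases Nat.eq_zero_or_pos j with rfl | hjpos
    -- Here the first character is trivial but vanishes at `0`, so the Jacobi sum is `-1`. The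
    -- general argument does not apply, since `Γ_p(0) = 1` is not covered by `gammaRat_div_pred`.
    · have hk : k + 1 = h := by omega
      rw [hk, Nat.cast_zero, zero_div, gammaRat_zero, div_self hhne, teichJacobi, pow_zero,
        jacobiSum_one_nontrivial hφ]
      simp
    · rw [hW j hjpos (by omega)]
      have hJ := dworkValue_mul_teichJacobi_of_lt p (by omega) (a := j) (b := h) (by omega) (by omega)
      have hr1 := hrefl (j + h) (k + 1) (by omega) (by omega) (by omega)
      have hr2 := hrefl h h hh0 hh0 (by omega)
      have hne := hWne (j + h) (by omega)
      rw [pow_add] at hr1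
      apply mul_left_cancel₀ hne
      have hgoal : dworkValue p (j + h) * -((-1) ^ j * (dworkValue p (k + 1) / dworkValue p h *
          dworkValue p j)) = -(dworkValue p j * dworkValue p h) := by
        field_simp
        linear_combination dworkValue p j * (hr2 - (-1) ^ j * hr1 + (-1) ^ h * hsq j)
      rw [hgoal]
      linear_combination -hJ
  · subst hjh
    have hdiff : (1 / 2 : ℚ) - (j : ℚ) / (2 * j) = 0 := by field_simp; ring
    rw [hdiff, Int.fract_zero, gammaRat_zero, Int.floor_zero, neg_zero, zpow_zero, mul_one,
      hW j hh0 (by omega), one_div, inv_mul_cancel₀ hhne, mul_one]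
    -- Both characters are quadratic, so the sum is `J(χ, χ⁻¹) = -χ(-1)`.
    have hinv : ((teichK p ℚ_[p])⁻¹ ^ j)⁻¹ = (teichK p ℚ_[p])⁻¹ ^ j := by
      rw [_root_.inv_eq_iff_mul_eq_one, ← pow_add, teichK_inv_pow_eq_one_iff, hh]
      exact ⟨1, by omega⟩
    have hJ := jacobiSum_nontrivial_inv hφ
    rw [hinv] at hJ
    have : (-1 : ZMod p) = ((-1 : (ZMod p)ˣ) : ZMod p) := by simp
    rw [teichJacobi, hJ, this, MulChar.pow_apply_coe, MulChar.inv_apply_eq_inv', Units.val_neg,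
      Units.val_one, teichK_neg_one p h2, inv_neg_one]
  · obtain ⟨c, rfl⟩ := Nat.exists_eq_add_of_lt hjh
    obtain ⟨d, hd⟩ : ∃ d, c + 1 + d = h ∧ 0 < d := ⟨h - (c + 1), by omega, by omega⟩
    obtain ⟨hd, hd0⟩ := hd
    -- The difference is negative, with floor `-1`. This puts the factor `-p` into `halfFactor`,
    -- matching the power of `p` in the Jacobi sum with a carry.
    have hdiff : (1 / 2 : ℚ) - ((h + c + 1 : ℕ) : ℚ) / (2 * h) =
        ((h + d : ℕ) : ℚ) / (2 * h) + (-1 : ℤ) := by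
      field_simp
      have := congrArg (Nat.cast (R := ℚ)) hd
      push_cast at this ⊢
      linear_combination -this
    have hlt : ((h + d : ℕ) : ℚ) / (2 * h) < 1 := by
      rw [div_lt_one (by positivity)]
      exact_mod_cast (by omega : h + d < 2 * h)
    have hfr : Int.fract (((h + d : ℕ) : ℚ) / (2 * h)) = ((h + d : ℕ) : ℚ) / (2 * h) :=
      Int.fract_eq_self.2 ⟨by positivity, hlt⟩
    have hfl2 : ⌊((h + d : ℕ) : ℚ) / (2 * h)⌋ = 0 :=
      Int.floor_eq_zero_iff.2 ⟨by positivity, hlt⟩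
    rw [hdiff, Int.fract_add_intCast, hfr, Int.floor_add_intCast, hfl2, zero_add, neg_neg, zpow_one,
      hW (h + d) (by omega) (by omega), hW (h + c + 1) (by omega) (by omega)]
    have hJ := dworkValue_mul_teichJacobi_of_add p (by omega) (a := h + c + 1) (b := h) (c := c + 1)
      (by omega) (by omega) (by omega) (by omega)
    have hr1 := hrefl (c + 1) (h + d) (by omega) (by omega) (by omega)
    have hr2 := hrefl h h hh0 hh0 (by omega)
    have hne := hWne (c + 1) (by omega)
    apply mul_left_cancel₀ hne
    rw [hJ]
    have hs : (-1 : ℚ_[p]) ^ (h + c + 1) * (-1) ^ (c + 1) = (-1) ^ h := by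
      rw [add_assoc, pow_add, mul_assoc, hsq, mul_one]
    field_simp
    linear_combination (p * dworkValue p (h + c + 1)) * (hr2 - (-1) ^ (h + c + 1) * hr1 + hs)

theorem teichmullerChar_pow_half (h2 : p ≠ 2) :
    teichmullerChar p ^ ((p - 1) / 2) = (teichmullerChar p)⁻¹ ^ ((p - 1) / 2) := by
  obtain ⟨h, hh⟩ : ∃ h, p = 2 * h + 1 := hp.out.odd_of_ne_two h2
  rw [inv_pow, _root_.eq_inv_iff_mul_eq_one, ← pow_add]
  ext x
  rw [MulChar.pow_apply_coe, MulChar.one_apply_coe, ← map_pow,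
    show (p - 1) / 2 + (p - 1) / 2 = p - 1 by omega, ZMod.pow_card_sub_one_eq_one x.ne_zero, map_one]

/-- The terms `t = 0` and `t = 1` of the Jacobi sum vanish because every character is `0` at `0`.
The quadratic character is its own inverse, so its sign convention does not matter. -/
theorem sum_Icc_eq_teichJacobi (h2 : p ≠ 2) (j : ℕ) :
    ∑ t ∈ Finset.Icc 2 (p - 1), ((((teichmullerChar p)⁻¹ ^ j) (t : ZMod p) : ℤ_[p]) : ℚ_[p]) *
      (((teichmullerChar p ^ ((p - 1) / 2)) (1 - (t : ZMod p)) : ℤ_[p]) : ℚ_[p]) =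
      teichJacobi p j ((p - 1) / 2) := by
  have hp2 := hp.out.two_le
  simp only [teichJacobi, jacobiSum, teichK_inv_pow_apply, teichmullerChar_pow_half p h2,
    Algebra.algebraMap_self, RingHom.id_apply]
  refine Finset.sum_of_injOn (fun t : ℕ => (t : ZMod p)) ?_ (fun _ _ => Finset.mem_coe.2 (Finset.mem_univ _)) ?_
    (fun _ _ => rfl)
  · intro a ha b hb hab
    have ha := Finset.mem_Icc.1 (Finset.mem_coe.1 ha)
    have hb := Finset.mem_Icc.1 (Finset.mem_coe.1 hb)
    have := (ZMod.natCast_eq_natCast_iff' a b p).1 hab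
    rwa [Nat.mod_eq_of_lt (by omega), Nat.mod_eq_of_lt (by omega)] at this
  · intro x _ hx
    have hval : x.val < 2 := by
      by_contra hlt
      refine hx ⟨x.val, ?_, ZMod.natCast_zmod_val x⟩
      have := x.val_lt
      exact Finset.mem_coe.2 (Finset.mem_Icc.2 (by omega))
    have hx' := ZMod.natCast_zmod_val x
    have h01 : x = 0 ∨ x = 1 := by
      rcases (by omega : x.val = 0 ∨ x.val = 1) with h | h
      · left; rw [← hx', h, Nat.cast_zero]
      · right; rw [← hx', h, Nat.cast_one]
    rcases h01 with rfl | rfl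
    · rw [MulChar.map_zero]; simp
    · rw [sub_self, MulChar.map_zero]; simp

end PadicHypergeometric

end

/-! ### The theorem: comparison of the terms for each `j` -/

theorem theorem2p6 (p : ℕ) [Fact p.Prime] (hp : p ≠ 2) (n : ℕ) (hn : 1 ≤ n)
    (a : Fin n → ℚ) (ha : ∀ i, ‖((a i : ℚ) : ℚ_[p])‖ ≤ 1) (s : ZMod p) :
    PadicHypergeometric.G p (Fin.snoc (α := fun _ => ℚ) a (1 / 2)) (fun _ : Fin (n + 1) => 1) s =
      -∑ t ∈ Finset.Icc 2 (p - 1),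
        PadicHypergeometric.G p a (fun _ : Fin n => 1) (s * (t : ZMod p)) *
          (((PadicHypergeometric.teichmullerChar p ^ ((p - 1) / 2)) (1 - (t : ZMod p)) : ℤ_[p]) :
            ℚ_[p]) := by
  simp only [PadicHypergeometric.G, Fin.prod_univ_castSucc, Fin.snoc_castSucc, Fin.snoc_last]
  simp only [mul_assoc (-1 / ((p : ℚ_[p]) - 1)), Finset.sum_mul]
  -- After the sums are interchanged, the common prefactor is removed and the terms with equal `j`
  -- are compared.
  rw [← Finset.mul_sum, Finset.sum_comm, ← mul_neg, ← Finset.sum_neg_distrib]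
  congr 1
  refine Finset.sum_congr rfl fun j hj => ?_
  have hj : j < p - 1 := Finset.mem_range.1 hj
  have hJ := PadicHypergeometric.teichJacobi_half_eq p hp hj
  rw [← PadicHypergeometric.sum_Icc_eq_teichJacobi p hp j, PadicHypergeometric.halfFactor] at hJ
  simp only [map_mul, PadicInt.coe_mul]
  -- The extra sign `(-1)^j` from the additional parameter pair is the one appearing in
  -- `teichJacobi_half_eq`.
  rw [mul_add_one, pow_add]
  have hsum : ∀ c d P : ℚ_[p], ∑ t ∈ Finset.Icc 2 (p - 1), c *
      (d * ((((PadicHypergeometric.teichmullerChar p)⁻¹ ^ j) (t : ZMod p) : ℤ_[p]) : ℚ_[p])) * P *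
      (((PadicHypergeometric.teichmullerChar p ^ ((p - 1) / 2)) (1 - (t : ZMod p)) : ℤ_[p]) :
        ℚ_[p]) = c * d * P * ∑ t ∈ Finset.Icc 2 (p - 1),
      ((((PadicHypergeometric.teichmullerChar p)⁻¹ ^ j) (t : ZMod p) : ℤ_[p]) : ℚ_[p]) *
      (((PadicHypergeometric.teichmullerChar p ^ ((p - 1) / 2)) (1 - (t : ZMod p)) : ℤ_[p]) :
        ℚ_[p]) := by
    intro c d P
    rw [Finset.mul_sum]
    exact Finset.sum_congr rfl fun t _ => by ring
  rw [hsum, hJ]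
  ring
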